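/- Let $d\in\mathbb N$ and $\Lambda\in\mathbb R$. For a function $u$ on the open ball $B_3=B_3(0)\subset\mathbb R^d$, $p\in B_3$ and $r>0$ with $\overline{B_r(p)}\subset B_3$ put $$D(p,r)=\int_{B_r(p)}|\nabla u|^2\,dX,\qquad H(p,r)=\int_{\partial B_r(p)}|u-u(p)|^2\,d\sigma,\qquad N(p,r)=\frac{r\,D(p,r)}{H(p,r)},$$ where $\sigma$ is the $(d-1)$-dimensional surface measure, and put $W(X,r)=N(X,\tfrac{3r}{2})-N(X,\tfrac r2)$ and $N(0,3)=\lim_{\rho\uparrow 3}N(0,\rho)$. There is a constant $C>0$ depending only on $d$ and $\Lambda$ such that the following holds for every non-constant harmonic function $u$ in $B_3$ for which $N(0,3)$ is finite and $N(0,3)\le\Lambda$, every $0<r<1$, and all $X_1,X_2\in B_1(0)$ with $|X_1-X_2|\le r/2$: $$|N(X_1,r)-N(X_2,r)|\le C\left(W(X_1,r)^{1/2}+W(X_2,r)^{1/2}\right).$$ If moreover $\nabla u(X_1)=0$, then also $$|u(X_1)-u(X_2)|\le C\left(W(X_1,r)^{1/2}+W(X_2,r)^{1/2}\right)\left(\frac{1}{|B_r(X_1)|}\int_{B_r(X_1)}|u-u(X_1)|^2\,dZ\right)^{1/2}.$$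 -/

import Mathlib

open MeasureTheory Metric Filter Topology

noncomputable section

/-- The Dirichlet energy `D(p, r) = ∫_{B_r(p)} |∇u|² dX`. -/
def energyD {d : ℕ} (u : EuclideanSpace ℝ (Fin d) → ℝ) (p : EuclideanSpace ℝ (Fin d)) (r : ℝ) :
    ℝ :=
  ∫ x in ball p r, ‖gradient u x‖ ^ 2

/-- The normalized height `H(p, r) = ∫_{∂B_r(p)} |u - u(p)|² dσ`, where `σ` is the
`(d-1)`-dimensional surface measure. The sphere `∂B_r(p)` is parametrized by the unit sphere
through `ω ↦ p + r ω`, under which `dσ = r^(d-1) dω`, and `dω` is the surface measure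
`volume.toSphere` of the unit sphere (of total mass `d · |B_1|`). Mathlib's Hausdorff measure
`μH[d-1]` is not used, since on Euclidean space it differs from the surface measure by a
dimensional factor. -/
def heightH {d : ℕ} (u : EuclideanSpace ℝ (Fin d) → ℝ) (p : EuclideanSpace ℝ (Fin d)) (r : ℝ) :
    ℝ :=
  r ^ (d - 1) * ∫ ω : sphere (0 : EuclideanSpace ℝ (Fin d)) 1,
    (u (p + r • (ω : EuclideanSpace ℝ (Fin d))) - u p) ^ 2
      ∂((volume : Measure (EuclideanSpace ℝ (Fin d))).toSphere)

/-- The normalized frequency function `N(p, r) = r D(p, r) / H(p, r)`. -/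
def normFreq {d : ℕ} (u : EuclideanSpace ℝ (Fin d) → ℝ) (p : EuclideanSpace ℝ (Fin d)) (r : ℝ) :
    ℝ :=
  r * energyD u p r / heightH u p r

/-- The frequency drop `W(X, r) = N(X, 3r/2) - N(X, r/2)`. -/
def freqDrop {d : ℕ} (u : EuclideanSpace ℝ (Fin d) → ℝ) (X : EuclideanSpace ℝ (Fin d)) (r : ℝ) :
    ℝ :=
  normFreq u X (3 * r / 2) - normFreq u X (r / 2)

end

/-!
The proof compares `u` with homogeneous harmonic functions through the Euler operator
`euler p f x = ∇f(x) · (x - p)`. Put `v = u - u(p)`. By Green's identity the frequency `N(p, s)` is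
the Rayleigh quotient `⟨v, euler p v⟩ / ⟨v, v⟩` on the sphere of radius `s` about `p`
(`normFreq_eq_sphFreq`), and `euler p` is symmetric on harmonic functions for this `L²` product
(`SmoothHarmonicOn.sphInt_mul_euler_comm`). Hence `N' = (2 / s) ‖euler p v - N v‖² / ‖v‖²`
(`SmoothHarmonicOn.hasDerivAt_sphFreq`): the frequency is monotone, and by the mean value theorem a
small drop `W(X, r)` provides a radius `s` between `5r/4` and `3r/2` at which
`g = euler X v - N(X, s) v` is small. As `g` is harmonic, it is of size `√W` on the
whole ball `B_r(X)` (`SmoothHarmonicOn.exists_abs_euler_sub_le`).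

For two centres let `e = X₂ - X₁`, and let `Mᵢ`, `gᵢ` be the frequency and the function `g` so
obtained about `Xᵢ`. Then `∂ₑ u = euler X₁ u - euler X₂ u` equals `(M₁ - M₂)(u - u(X₁))` up to a
constant and an error `g₁ - g₂`. On the other hand `∂ₑ` lowers the degree of homogeneity by one, so
that `∂ₑ u` is orthogonal to `u - u(X₁)` on spheres about `X₁`, up to an error controlled by `g₁`;
precisely, this comes from the symmetry of `euler X₁` and from `[∂ₑ, euler X₁] = ∂ₑ`. Constants are
orthogonal to `u - u(X₁)` by the mean value property, so `M₁ - M₂` is of size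
`√W(X₁, r) + √W(X₂, r)` (`SmoothHarmonicOn.sphInt_eq_sub_mul_sphHeight`,
`SmoothHarmonicOn.abs_sphFreq_sub_le`). If `∇u(X₁) = 0`, then `g₂(X₁) = -M₂ (u(X₁) - u(X₂))`, and
`M₂ ≥ 1` because `u - u(X₂)` vanishes at `X₂`; this is the second estimate
(`SmoothHarmonicOn.abs_sub_le_of_dirD_eq_zero`).

Heights about different centres and radii are comparable by the doubling inequality, which amounts
to an upper bound for the frequency; the bound at `0` passes to all centres in the unit ball
(`SmoothHarmonicOn.sphFreq_le_of_mem_ball`). The underlying facts about harmonic functions are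
derived from the divergence theorem on balls, which is obtained from integration by parts against
radial functions and polar coordinates (`sphInt_mul_inner`). Harmonic functions are smooth, being
invariant under averaging against radial bump functions; they may therefore be replaced by smooth
functions on the whole space, harmonic on a slightly smaller ball (`exists_smoothHarmonicOn`).
-/

open scoped ContDiff RealInnerProductSpace

set_option linter.unusedSectionVars false

/-! ### Directional derivatives, the Laplacian and the Euler field -/

section Calculus

variable {E : Type*} [NormedAddCommGroup E] [InnerProductSpace ℝ E]

/-- The directional derivative `∂ₑ f`, as an operator on functions. -/
noncomputable def dirD (e : E) (f : E → ℝ) : E → ℝ := fun x => fderiv ℝ f x e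

/-- The Euler operator centred at `p`: `euler p f x = ∇f(x) · (x - p)`. -/
noncomputable def euler (p : E) (f : E → ℝ) : E → ℝ := fun x => fderiv ℝ f x (x - p)

lemma contDiff_dirD {n m : ℕ∞ω} {f : E → ℝ} (hf : ContDiff ℝ n f) (hmn : m + 1 ≤ n) (e : E) :
    ContDiff ℝ m (dirD e f) :=
  (hf.fderiv_right hmn).clm_apply contDiff_const

lemma contDiff_euler {n m : ℕ∞ω} {f : E → ℝ} (hf : ContDiff ℝ n f) (hmn : m + 1 ≤ n) (p : E) :
    ContDiff ℝ m (euler p f) :=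
  (hf.fderiv_right hmn).clm_apply (contDiff_id.sub contDiff_const)

lemma dirD_add {f g : E → ℝ} (hf : Differentiable ℝ f) (hg : Differentiable ℝ g) (e x : E) :
    dirD e (fun y => f y + g y) x = dirD e f x + dirD e g x := by
  simp [dirD, fderiv_fun_add (hf x) (hg x)]

lemma dirD_mul {f g : E → ℝ} (hf : Differentiable ℝ f) (hg : Differentiable ℝ g) (e x : E) :
    dirD e (fun y => f y * g y) x = dirD e f x * g x + f x * dirD e g x := by
  simp [dirD, fderiv_fun_mul (hf x) (hg x)]; ring

lemma euler_mul {f g : E → ℝ} (hf : Differentiable ℝ f) (hg : Differentiable ℝ g) (p x : E) :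
    euler p (fun y => f y * g y) x = euler p f x * g x + f x * euler p g x := by
  simp [euler, fderiv_fun_mul (hf x) (hg x)]; ring

lemma dirD_sub_const (f : E → ℝ) (c : ℝ) (e : E) : dirD e (fun y => f y - c) = dirD e f := by
  funext x; unfold dirD; rw [fderiv_sub_const c]

lemma euler_sub_const (f : E → ℝ) (c : ℝ) (p : E) : euler p (fun y => f y - c) = euler p f := by
  funext x; unfold euler; rw [fderiv_sub_const c]

lemma dirD_const_mul {f : E → ℝ} (hf : Differentiable ℝ f) (c : ℝ) (e x : E) :
    dirD e (fun y => c * f y) x = c * dirD e f x := by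
  simp [dirD, fderiv_const_mul (hf x)]

lemma dirD_sub {f g : E → ℝ} (hf : Differentiable ℝ f) (hg : Differentiable ℝ g) (e x : E) :
    dirD e (fun y => f y - g y) x = dirD e f x - dirD e g x := by
  simp [dirD, fderiv_fun_sub (hf x) (hg x)]

lemma dirD_dirD {f : E → ℝ} (hf : ContDiff ℝ 2 f) (e e' x : E) :
    dirD e (dirD e' f) x = fderiv ℝ (fderiv ℝ f) x e e' := by
  have h1 : DifferentiableAt ℝ (fderiv ℝ f) x :=
    (hf.fderiv_right (m := 1) (by norm_num)).differentiable (by simp) x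
  change fderiv ℝ (fun y => fderiv ℝ f y e') x e = _
  rw [fderiv_clm_apply h1 (differentiableAt_const _)]
  simp

lemma fderiv_fderiv_comm {f : E → ℝ} (hf : ContDiff ℝ 2 f) (e e' x : E) :
    fderiv ℝ (fderiv ℝ f) x e e' = fderiv ℝ (fderiv ℝ f) x e' e :=
  (hf.contDiffAt.isSymmSndFDerivAt (by simp)) e e'

lemma dirD_comm {f : E → ℝ} (hf : ContDiff ℝ 2 f) (e e' : E) :
    dirD e (dirD e' f) = dirD e' (dirD e f) := by
  funext x
  rw [dirD_dirD hf, dirD_dirD hf, fderiv_fderiv_comm hf]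

/-- The commutation relation `[∂ₑ, euler p] = ∂ₑ`. -/
lemma dirD_euler {f : E → ℝ} (hf : ContDiff ℝ 2 f) (e p x : E) :
    dirD e (euler p f) x = dirD e f x + euler p (dirD e f) x := by
  have h1 : DifferentiableAt ℝ (fderiv ℝ f) x :=
    (hf.fderiv_right (m := 1) (by norm_num)).differentiable (by simp) x
  have h2 : euler p (dirD e f) x = fderiv ℝ (fderiv ℝ f) x (x - p) e := dirD_dirD hf _ _ _
  have h3 : dirD e (euler p f) x = fderiv ℝ (fderiv ℝ f) x e (x - p) + fderiv ℝ f x e := by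
    change fderiv ℝ (fun y => fderiv ℝ f y (y - p)) x e = _
    rw [fderiv_clm_apply h1 (by fun_prop)]
    simp [fderiv_sub_const, add_comm]
  rw [h2, h3, fderiv_fderiv_comm hf, add_comm]; rfl

variable [FiniteDimensional ℝ E]

/-- The Laplacian as a sum of second directional derivatives along an orthonormal basis. It agrees
with Mathlib's `Laplacian` on `C²` functions, see `laplacian_eq_lapl`. -/
noncomputable def lapl (f : E → ℝ) : E → ℝ := fun x =>
  ∑ i, dirD (stdOrthonormalBasis ℝ E i) (dirD (stdOrthonormalBasis ℝ E i) f) x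

lemma laplacian_eq_lapl {f : E → ℝ} (hf : ContDiff ℝ 2 f) (x : E) :
    Laplacian.laplacian f x = lapl f x := by
  rw [InnerProductSpace.laplacian_eq_iteratedFDeriv_stdOrthonormalBasis]
  simp only [lapl, dirD_dirD hf]
  refine Finset.sum_congr rfl fun i _ => ?_
  rw [iteratedFDeriv_two_apply]
  simp

lemma euler_eq_sum (p : E) (f : E → ℝ) (x : E) :
    euler p f x
      = ∑ i, ⟪stdOrthonormalBasis ℝ E i, x - p⟫ * dirD (stdOrthonormalBasis ℝ E i) f x := by
  unfold euler dirD
  conv_lhs => rw [← (stdOrthonormalBasis ℝ E).sum_repr' (x - p)]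
  simp

lemma lapl_congr {f g : E → ℝ} {x : E} (h : f =ᶠ[𝓝 x] g) : lapl f x = lapl g x := by
  unfold lapl dirD
  refine Finset.sum_congr rfl fun i _ => ?_
  have : (fun y => fderiv ℝ f y (stdOrthonormalBasis ℝ E i)) =ᶠ[𝓝 x]
      fun y => fderiv ℝ g y (stdOrthonormalBasis ℝ E i) := by
    filter_upwards [h.eventuallyEq_nhds] with y hy
    rw [hy.fderiv_eq]
  rw [this.fderiv_eq]

lemma lapl_sub_const (f : E → ℝ) (c : ℝ) : lapl (fun y => f y - c) = lapl f := by
  funext x; simp only [lapl, dirD_sub_const]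

lemma lapl_dirD {f : E → ℝ} (hf : ContDiff ℝ ∞ f) (e : E) : lapl (dirD e f) = dirD e (lapl f) := by
  have h2 : ∀ {g : E → ℝ}, ContDiff ℝ ∞ g → ContDiff ℝ 2 g := fun h => mod_cast contDiff_infty.1 h 2
  have hd : ∀ {g : E → ℝ} (e : E), ContDiff ℝ ∞ g → ContDiff ℝ ∞ (dirD e g) :=
    fun e h => contDiff_dirD h (by simp) e
  funext x
  unfold lapl
  have : dirD e (fun x => ∑ i, dirD (stdOrthonormalBasis ℝ E i)
      (dirD (stdOrthonormalBasis ℝ E i) f) x) x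
      = ∑ i, dirD e (dirD (stdOrthonormalBasis ℝ E i) (dirD (stdOrthonormalBasis ℝ E i) f)) x := by
    rw [dirD, fderiv_fun_sum fun i _ => (hd _ (hd _ hf)).differentiable (by simp) x]
    simp [dirD]
  rw [this]
  refine Finset.sum_congr rfl fun i _ => ?_
  rw [dirD_comm (h2 hf) _ e, dirD_comm (h2 (hd _ hf)) _ e]

lemma lapl_euler {f : E → ℝ} (hf : ContDiff ℝ ∞ f) (p x : E) :
    lapl (euler p f) x = 2 * lapl f x + euler p (lapl f) x := by
  have h2 : ∀ {g : E → ℝ}, ContDiff ℝ ∞ g → ContDiff ℝ 2 g := fun h => mod_cast contDiff_infty.1 h 2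
  have hd : ∀ {g : E → ℝ} (e : E), ContDiff ℝ ∞ g → ContDiff ℝ ∞ (dirD e g) :=
    fun e h => contDiff_dirD h (by simp) e
  have he : ∀ {g : E → ℝ}, ContDiff ℝ ∞ g → ContDiff ℝ ∞ (euler p g) :=
    fun h => contDiff_euler h (by simp) p
  have : euler p (lapl f) x
      = ∑ i, euler p (dirD (stdOrthonormalBasis ℝ E i) (dirD (stdOrthonormalBasis ℝ E i) f)) x := by
    unfold euler lapl
    rw [fderiv_fun_sum fun i _ => (hd _ (hd _ hf)).differentiable (by simp) x]
    simp
  rw [this]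
  unfold lapl
  rw [Finset.mul_sum, ← Finset.sum_add_distrib]
  refine Finset.sum_congr rfl fun i _ => ?_
  have h3 : dirD (stdOrthonormalBasis ℝ E i) (euler p f) = fun y =>
      dirD (stdOrthonormalBasis ℝ E i) f y + euler p (dirD (stdOrthonormalBasis ℝ E i) f) y :=
    funext fun y => dirD_euler (h2 hf) _ _ _
  rw [h3, dirD_add ((hd _ hf).differentiable (by simp)) ((he (hd _ hf)).differentiable (by simp)),
    dirD_euler (h2 (hd _ hf))]
  ring

/-- `u` is smooth on the whole space and harmonic on the set `U`. Solutions on a ball are replaced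
by functions of this kind, which agree with them on a slightly smaller ball. -/
structure SmoothHarmonicOn (u : E → ℝ) (U : Set E) : Prop where
  smooth : ContDiff ℝ ∞ u
  lapl_eq_zero : ∀ x ∈ U, lapl u x = 0

namespace SmoothHarmonicOn

variable {u v : E → ℝ} {U V : Set E}

lemma mono (hu : SmoothHarmonicOn u U) (h : V ⊆ U) : SmoothHarmonicOn u V :=
  ⟨hu.smooth, fun x hx => hu.lapl_eq_zero x (h hx)⟩

lemma differentiable (hu : SmoothHarmonicOn u U) : Differentiable ℝ u :=
  hu.smooth.differentiable (by simp)

lemma contDiff_two (hu : SmoothHarmonicOn u U) : ContDiff ℝ 2 u :=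
  mod_cast contDiff_infty.1 hu.smooth 2

lemma contDiff_one (hu : SmoothHarmonicOn u U) : ContDiff ℝ 1 u :=
  mod_cast contDiff_infty.1 hu.smooth 1

lemma continuous (hu : SmoothHarmonicOn u U) : Continuous u := hu.smooth.continuous

lemma sub_const (hu : SmoothHarmonicOn u U) (c : ℝ) : SmoothHarmonicOn (fun x => u x - c) U :=
  ⟨hu.smooth.sub contDiff_const, fun x hx => by rw [lapl_sub_const]; exact hu.lapl_eq_zero x hx⟩

lemma dirD (hu : SmoothHarmonicOn u U) (hU : IsOpen U) (e : E) :
    SmoothHarmonicOn (dirD e u) U := by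
  refine ⟨contDiff_dirD hu.smooth (by simp) e, fun x hx => ?_⟩
  rw [lapl_dirD hu.smooth]
  have : lapl u =ᶠ[𝓝 x] fun _ => 0 := by
    filter_upwards [hU.mem_nhds hx] with y hy using hu.lapl_eq_zero y hy
  unfold _root_.dirD
  simp [this.fderiv_eq]

lemma euler (hu : SmoothHarmonicOn u U) (hU : IsOpen U) (p : E) :
    SmoothHarmonicOn (euler p u) U := by
  refine ⟨contDiff_euler hu.smooth (by simp) p, fun x hx => ?_⟩
  rw [lapl_euler hu.smooth]
  have : lapl u =ᶠ[𝓝 x] fun _ => 0 := by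
    filter_upwards [hU.mem_nhds hx] with y hy using hu.lapl_eq_zero y hy
  unfold _root_.euler
  simp [this.fderiv_eq, hu.lapl_eq_zero x hx]

lemma sub_const_mul (hu : SmoothHarmonicOn u U) (hv : SmoothHarmonicOn v U) (c : ℝ) :
    SmoothHarmonicOn (fun x => u x - c * v x) U := by
  refine ⟨hu.smooth.sub (contDiff_const.mul hv.smooth), fun x hx => ?_⟩
  have hd : ∀ {g : E → ℝ} (e : E), ContDiff ℝ ∞ g → Differentiable ℝ (_root_.dirD e g) :=
    fun e h => (contDiff_dirD (m := ∞) h (by simp) e).differentiable (by simp)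
  have key : ∀ (f g : E → ℝ), Differentiable ℝ f → Differentiable ℝ g → ∀ e : E,
      _root_.dirD e (fun y => f y - c * g y)
        = fun y => _root_.dirD e f y - c * _root_.dirD e g y := by
    intro f g hf hg e
    funext y
    rw [dirD_sub hf (hg.const_mul c), dirD_const_mul hg]
  have : lapl (fun x => u x - c * v x) x = lapl u x - c * lapl v x := by
    unfold lapl
    rw [Finset.mul_sum, ← Finset.sum_sub_distrib]
    refine Finset.sum_congr rfl fun i _ => ?_
    rw [key u v hu.differentiable hv.differentiable, key _ _ (hd _ hu.smooth) (hd _ hv.smooth)]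
  rw [this, hu.lapl_eq_zero x hx, hv.lapl_eq_zero x hx]; simp

end SmoothHarmonicOn

end Calculus

/-! ### Integrals over spheres and polar coordinates -/

section Sphere

variable {E : Type*} [NormedAddCommGroup E] [InnerProductSpace ℝ E] [FiniteDimensional ℝ E]
  [MeasureSpace E] [BorelSpace E] [(volume : Measure E).IsAddHaarMeasure]

/-- The integral of `f` over the sphere of radius `s` about `p`, with respect to the surface measure
of the *unit* sphere: `∫ f(p + s z) dz`. With this normalization no factor `s ^ (n - 1)` occurs. -/
noncomputable def sphInt (p : E) (s : ℝ) (f : E → ℝ) : ℝ :=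
  ∫ z : sphere (0 : E) 1, f (p + s • (z : E)) ∂(volume : Measure E).toSphere

variable (E) in
/-- The area of the unit sphere of `E`. -/
noncomputable def sphArea : ℝ := (volume : Measure E).toSphere.real Set.univ

lemma integrable_sphere {f : E → ℝ} (hf : Continuous f) (p : E) (s : ℝ) :
    Integrable (fun z : sphere (0 : E) 1 => f (p + s • (z : E))) (volume : Measure E).toSphere :=
  (hf.comp (by fun_prop)).integrable_of_hasCompactSupport (HasCompactSupport.of_compactSpace _)

lemma sphere_norm_sub (p : E) {s : ℝ} (hs : 0 ≤ s) (z : sphere (0 : E) 1) :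
    ‖p + s • (z : E) - p‖ = s := by
  simp [norm_smul, abs_of_nonneg hs]

lemma sphArea_pos [Nontrivial E] : 0 < sphArea E := by
  rw [sphArea, Measure.toSphere_real_apply_univ]
  have h1 : 0 < Module.finrank ℝ E := Module.finrank_pos
  have h2 : 0 < (volume : Measure E).real (ball 0 1) :=
    ENNReal.toReal_pos (measure_ball_pos _ _ one_pos).ne' measure_ball_lt_top.ne
  positivity

lemma sphInt_const (p : E) (s c : ℝ) : sphInt p s (fun _ => c) = sphArea E * c := by
  simp [sphInt, sphArea]

lemma sphInt_congr {p : E} {s : ℝ} (hs : 0 ≤ s) {f g : E → ℝ}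
    (h : ∀ x, ‖x - p‖ = s → f x = g x) : sphInt p s f = sphInt p s g :=
  integral_congr_ae (Eventually.of_forall fun z => h _ (sphere_norm_sub p hs z))

lemma sphInt_zero_radius (p : E) (f : E → ℝ) : sphInt p 0 f = sphArea E * f p := by
  simp [sphInt, sphArea]

lemma sphInt_add (p : E) (s : ℝ) {f g : E → ℝ} (hf : Continuous f) (hg : Continuous g) :
    sphInt p s (fun x => f x + g x) = sphInt p s f + sphInt p s g :=
  integral_add (integrable_sphere hf p s) (integrable_sphere hg p s)

lemma sphInt_sub (p : E) (s : ℝ) {f g : E → ℝ} (hf : Continuous f) (hg : Continuous g) :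
    sphInt p s (fun x => f x - g x) = sphInt p s f - sphInt p s g :=
  integral_sub (integrable_sphere hf p s) (integrable_sphere hg p s)

lemma sphInt_const_mul (p : E) (s c : ℝ) (f : E → ℝ) :
    sphInt p s (fun x => c * f x) = c * sphInt p s f :=
  integral_const_mul c _

lemma sphInt_mono {p : E} {s : ℝ} (hs : 0 ≤ s) {f g : E → ℝ} (hf : Continuous f)
    (hg : Continuous g) (h : ∀ x, ‖x - p‖ = s → f x ≤ g x) : sphInt p s f ≤ sphInt p s g :=
  integral_mono (integrable_sphere hf p s) (integrable_sphere hg p s)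
    fun z => h _ (sphere_norm_sub p hs z)

lemma sphInt_nonneg {p : E} {s : ℝ} {f : E → ℝ} (h : ∀ x, 0 ≤ f x) : 0 ≤ sphInt p s f :=
  integral_nonneg fun _ => h _

lemma sphInt_le {p : E} {s : ℝ} (hs : 0 ≤ s) {f : E → ℝ} (hf : Continuous f) {M : ℝ}
    (h : ∀ x, ‖x - p‖ = s → f x ≤ M) : sphInt p s f ≤ sphArea E * M := by
  rw [← sphInt_const p s M]
  exact sphInt_mono hs hf continuous_const h

lemma abs_sphInt_le {p : E} {s : ℝ} (hs : 0 ≤ s) {f : E → ℝ} (hf : Continuous f) {M : ℝ}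
    (h : ∀ x, ‖x - p‖ = s → |f x| ≤ M) : |sphInt p s f| ≤ sphArea E * M := by
  refine abs_le.2 ⟨?_, sphInt_le hs hf fun x hx => (le_abs_self _).trans (h x hx)⟩
  have := sphInt_mono hs (continuous_const (y := -M)) hf fun x hx => (abs_le.1 (h x hx)).1
  rw [sphInt_const] at this
  linarith

lemma continuous_sphInt {f : E → ℝ} (hf : Continuous f) (p : E) :
    Continuous fun s => sphInt p s f := by
  have h : Continuous (Function.uncurry fun (s : ℝ) (z : sphere (0 : E) 1) =>
      f (p + s • (z : E))) := by
    unfold Function.uncurry; fun_prop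
  have := continuous_parametric_integral_of_continuous
    (μ := (volume : Measure E).toSphere) h isCompact_univ
  simpa [sphInt] using this

lemma hasDerivAt_sphInt {f : E → ℝ} (hf : ContDiff ℝ 1 f) (p : E) {s : ℝ} (hs : 0 < s) :
    HasDerivAt (fun s => sphInt p s f) (sphInt p s (euler p f) / s) s := by
  have hd : Continuous (fderiv ℝ f) := hf.continuous_fderiv (by simp)
  obtain ⟨C, hC⟩ := (isCompact_closedBall p (s + 1)).exists_bound_of_continuousOn hd.continuousOn
  have hderiv : ∀ (z : sphere (0 : E) 1) (t : ℝ),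
      HasDerivAt (fun t : ℝ => f (p + t • (z : E))) (fderiv ℝ f (p + t • (z : E)) z) t := by
    intro z t
    have h1 : HasDerivAt (fun t : ℝ => p + t • (z : E)) (z : E) t := by
      simpa using ((hasDerivAt_id t).smul_const (z : E)).const_add p
    exact ((hf.differentiable (by simp)) _).hasFDerivAt.comp_hasDerivAt t h1
  have hmeas : ∀ t : ℝ, Continuous fun z : sphere (0 : E) 1 =>
      fderiv ℝ f (p + t • (z : E)) (z : E) := fun t =>
    (hd.comp (by fun_prop)).clm_apply (by fun_prop)
  have key := (hasDerivAt_integral_of_dominated_loc_of_deriv_le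
    (μ := (volume : Measure E).toSphere) (F := fun t (z : sphere (0 : E) 1) => f (p + t • (z : E)))
    (F' := fun t (z : sphere (0 : E) 1) => fderiv ℝ f (p + t • (z : E)) z) (x₀ := s)
    (s := ball s 1) (bound := fun _ => C) (ball_mem_nhds s one_pos)
    (Eventually.of_forall fun t => (integrable_sphere hf.continuous p t).aestronglyMeasurable)
    (integrable_sphere hf.continuous p s) (hmeas s).aestronglyMeasurable
    (Eventually.of_forall fun z t ht => ?_) (integrable_const C)
    (Eventually.of_forall fun z t _ => hderiv z t)).2
  · have h2 : sphInt p s (euler p f) / s = ∫ z : sphere (0 : E) 1,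
        fderiv ℝ f (p + s • (z : E)) z ∂(volume : Measure E).toSphere := by
      rw [sphInt, div_eq_inv_mul, ← integral_const_mul]
      refine integral_congr_ae (Eventually.of_forall fun z => ?_)
      simp [euler, hs.ne']
    rw [h2]
    exact key
  · have h1 : p + t • (z : E) ∈ closedBall p (s + 1) := by
      rw [mem_closedBall, dist_eq_norm]
      rw [mem_ball, Real.dist_eq] at ht
      have : |t| ≤ s + 1 := by
        have := abs_lt.1 ht
        exact abs_le.2 ⟨by linarith, by linarith⟩
      simpa [norm_smul] using this
    calc ‖fderiv ℝ f (p + t • (z : E)) z‖ ≤ ‖fderiv ℝ f (p + t • (z : E))‖ * ‖(z : E)‖ :=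
          ContinuousLinearMap.le_opNorm _ _
      _ ≤ C := by simpa using hC _ h1

/-- Polar coordinates. -/
lemma integral_eq_integral_sphInt [Nontrivial E] {f : E → ℝ} (hf : Integrable f) :
    ∫ x, f x = ∫ s in Set.Ioi (0 : ℝ), s ^ (Module.finrank ℝ E - 1) * sphInt 0 s f := by
  have h1 := (volume : Measure E).measurePreserving_homeomorphUnitSphereProd
  have hemb := (homeomorphUnitSphereProd E).measurableEmbedding
  set F : sphere (0 : E) 1 × Set.Ioi (0 : ℝ) → ℝ := fun w => f ((w.2 : ℝ) • (w.1 : E)) with hF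
  have hFc : ∀ x : ({(0)}ᶜ : Set E), F (homeomorphUnitSphereProd E x) = f x := by
    intro x
    have hx : ‖(x : E)‖ ≠ 0 := norm_ne_zero_iff.2 x.2
    simp [hF, smul_smul, hx]
  have hint : Integrable F ((volume : Measure E).toSphere.prod
      (Measure.volumeIoiPow (Module.finrank ℝ E - 1))) := by
    rw [← h1.integrable_comp_emb hemb]
    have : F ∘ (homeomorphUnitSphereProd E) = f ∘ Subtype.val := funext hFc
    rw [this, ← integrableOn_iff_comap_subtypeVal (by measurability)]
    exact hf.integrableOn
  calc ∫ x, f x = ∫ x : ({(0)}ᶜ : Set E), f x ∂((volume : Measure E).comap (↑)) := by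
        rw [integral_subtype_comap (measurableSet_singleton _).compl f,
          restrict_compl_singleton]
    _ = ∫ w, F w ∂((volume : Measure E).toSphere.prod
        (Measure.volumeIoiPow (Module.finrank ℝ E - 1))) := by
        rw [← h1.integral_comp hemb]
        exact integral_congr_ae (Eventually.of_forall fun x => (hFc x).symm)
    _ = ∫ s : Set.Ioi (0 : ℝ), sphInt 0 (s : ℝ) f
          ∂Measure.volumeIoiPow (Module.finrank ℝ E - 1) := by
        rw [integral_prod_symm _ hint]
        simp [hF, sphInt]
    _ = _ := by
        simp only [Measure.volumeIoiPow, ENNReal.ofReal]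
        rw [integral_withDensity_eq_integral_smul
            ((measurable_subtype_coe.pow_const _).real_toNNReal),
          integral_subtype_comap measurableSet_Ioi fun a : ℝ =>
            Real.toNNReal (a ^ (Module.finrank ℝ E - 1)) • sphInt 0 a f,
          setIntegral_congr_fun measurableSet_Ioi fun x hx => ?_]
        rw [NNReal.smul_def, Real.coe_toNNReal _ (pow_nonneg hx.out.le _), smul_eq_mul]

lemma setIntegral_ball_eq [Nontrivial E] {f : E → ℝ} (hf : Continuous f) (p : E) {r : ℝ}
    (hr : 0 ≤ r) :
    ∫ x in ball p r, f x = ∫ s in (0)..r, s ^ (Module.finrank ℝ E - 1) * sphInt p s f := by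
  set g : E → ℝ := (ball (0 : E) r).indicator fun x => f (p + x) with hg
  have hgi : Integrable g := by
    rw [hg, integrable_indicator_iff measurableSet_ball]
    exact ((hf.comp (by fun_prop : Continuous fun x => p + x)).continuousOn.integrableOn_compact
      (isCompact_closedBall 0 r)).mono_set ball_subset_closedBall
  have h1 : ∫ x in ball p r, f x = ∫ x, g x := by
    rw [← integral_indicator measurableSet_ball, ← integral_add_left_eq_self _ p]
    refine integral_congr_ae (Eventually.of_forall fun x => ?_)
    simp [hg, Set.indicator]
  rw [h1, integral_eq_integral_sphInt hgi, intervalIntegral.integral_of_le hr,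
    integral_Ioc_eq_integral_Ioo]
  have h2 : ∀ s ∈ Set.Ioi (0 : ℝ), s ^ (Module.finrank ℝ E - 1) * sphInt 0 s g
      = (Set.Iio r).indicator (fun s => s ^ (Module.finrank ℝ E - 1) * sphInt p s f) s := by
    intro s hs
    have hs' : |s| = s := abs_of_pos hs
    by_cases h : s < r <;> simp [hg, sphInt, Set.indicator, norm_smul, hs', h]
  rw [setIntegral_congr_fun measurableSet_Ioi h2, setIntegral_indicator measurableSet_Iio,
    Set.Ioi_inter_Iio]

/-! ### The divergence theorem on balls -/

/-- Integration by parts against the radial function `η(|x|²)`. -/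
lemma integral_radial_mul_dirD {f : E → ℝ} (hf : ContDiff ℝ 1 f) (e : E) {η ψ : ℝ → ℝ}
    (hη : ∀ t, HasDerivAt η (ψ t) t) (hψ : Continuous ψ) {M : ℝ} (hM : ∀ t, M ≤ t → η t = 0) :
    ∫ x, η (‖x‖ ^ 2) * dirD e f x = -∫ x, (2 * ψ (‖x‖ ^ 2)) * (f x * ⟪e, x⟫) := by
  set φ : E → ℝ := fun x => η (‖x‖ ^ 2) with hφ
  have hηc : Continuous η := continuous_iff_continuousAt.2 fun t => (hη t).continuousAt
  have hφd : ∀ x, HasFDerivAt φ (ψ (‖x‖ ^ 2) • (2 • (innerSL ℝ x))) x := fun x =>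
    (hη _).comp_hasFDerivAt x (hasStrictFDerivAt_norm_sq x).hasFDerivAt
  have hsupp : HasCompactSupport φ := by
    refine HasCompactSupport.of_support_subset_isCompact (isCompact_closedBall (0 : E) (|M| + 1))
      fun x hx => ?_
    by_contra hx'
    rw [mem_closedBall, dist_zero_right, not_le] at hx'
    refine hx (hM _ ?_)
    nlinarith [le_abs_self M, abs_nonneg M]
  have hψd : ∀ x, fderiv ℝ φ x e = 2 * ψ (‖x‖ ^ 2) * ⟪e, x⟫ := by
    intro x
    rw [(hφd x).fderiv]
    simp [real_inner_comm]; ring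
  have hφc : Continuous φ := hηc.comp (by fun_prop)
  have hfd : Continuous (dirD e f) :=
    (contDiff_dirD (m := 0) hf (by simp) e).continuous
  have hφ' : Continuous fun x => fderiv ℝ φ x e := by
    simp only [hψd]
    have := hψ.comp (by fun_prop : Continuous fun x : E => ‖x‖ ^ 2)
    simp only [Function.comp_def] at this
    fun_prop
  have hs' : HasCompactSupport fun x => fderiv ℝ φ x e := hsupp.fderiv_apply (𝕜 := ℝ) e
  have := integral_mul_fderiv_eq_neg_fderiv_mul_of_integrable (μ := (volume : Measure E))
    (f := φ) (g := f) (v := e)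
    ((hφ'.mul hf.continuous).integrable_of_hasCompactSupport hs'.mul_right)
    ((hφc.mul hfd).integrable_of_hasCompactSupport hsupp.mul_right)
    ((hφc.mul hf.continuous).integrable_of_hasCompactSupport hsupp.mul_right)
    (fun x _ => (hφd x).differentiableAt) (fun x _ => hf.differentiable (by simp) x)
  rw [show (fun x => η (‖x‖ ^ 2) * dirD e f x) = fun x => φ x * fderiv ℝ f x e from rfl, this]
  congr 2
  funext x
  rw [hψd]; ring

/-- The divergence theorem on a ball about the origin for the vector field `f e`, with `e` a
constant vector. It is obtained by testing `∂ₑ f` against radial functions. -/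
lemma sphInt_mul_inner_zero [Nontrivial E] {f : E → ℝ} (hf : ContDiff ℝ 1 f) (e : E) {s : ℝ}
    (hs : 0 < s) :
    s ^ (Module.finrank ℝ E - 1) * sphInt 0 s (fun x => f x * ⟪e, x⟫)
      = s * ∫ x in ball 0 s, dirD e f x := by
  set n := Module.finrank ℝ E - 1 with hn
  have hfd : Continuous (dirD e f) := (contDiff_dirD (m := 0) hf (by simp) e).continuous
  have hfe : Continuous fun x => f x * ⟪e, x⟫ := hf.continuous.mul (by fun_prop)
  set P : ℝ → ℝ := fun s => s ^ n * sphInt 0 s (fun x => f x * ⟪e, x⟫) with hP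
  set Q : ℝ → ℝ := fun s => s ^ n * sphInt 0 s (dirD e f) with hQ
  have hPc : Continuous P := (continuous_pow n).mul (continuous_sphInt hfe 0)
  have hQc : Continuous Q := (continuous_pow n).mul (continuous_sphInt hfd 0)
  set I : ℝ → ℝ := fun s => ∫ t in (0)..s, Q t with hI
  have hId : ∀ s, HasDerivAt I (Q s) s := fun s =>
    intervalIntegral.integral_hasDerivAt_right (hQc.intervalIntegrable _ _)
      (hQc.stronglyMeasurableAtFilter _ _) hQc.continuousAt
  have hIc : Continuous I := continuous_iff_continuousAt.2 fun t => (hId t).continuousAt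
  set G : ℝ → ℝ := fun s => P s - s * I s with hG
  have hGc : Continuous G := hPc.sub (continuous_id.mul hIc)
  have htest : ∀ g : ℝ → ℝ, ContDiff ℝ ∞ g → HasCompactSupport g → tsupport g ⊆ Set.Ioi 0 →
      ∫ x, g x • G x = 0 := by
    intro g hg hgs hgt
    have hgc := hg.continuous
    -- a bound `M` for the support of `g`
    obtain ⟨M, hM0, hM⟩ : ∃ M : ℝ, 0 < M ∧ ∀ t, M ≤ t → g t = 0 := by
      obtain ⟨M, hM⟩ := hgs.isCompact.isBounded.subset_closedBall 0
      refine ⟨|M| + 1, by positivity, fun t ht => ?_⟩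
      by_contra h
      have := hM (subset_tsupport g h)
      rw [mem_closedBall, dist_zero_right, Real.norm_eq_abs] at this
      linarith [le_abs_self t, le_abs_self M]
    have hg0 : ∀ t, t ≤ 0 → g t = 0 := fun t ht => by
      by_contra h
      exact absurd (hgt (subset_tsupport g h)) (by simpa using ht)
    set ψ : ℝ → ℝ := fun t => g (Real.sqrt t) with hψ
    have hψc : Continuous ψ := hgc.comp Real.continuous_sqrt
    set η : ℝ → ℝ := fun t => ∫ y in (M ^ 2)..t, ψ y with hη
    have hηd : ∀ t, HasDerivAt η (ψ t) t := fun t =>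
      intervalIntegral.integral_hasDerivAt_right (hψc.intervalIntegrable _ _)
        (hψc.stronglyMeasurableAtFilter _ _) hψc.continuousAt
    have hη0 : ∀ t, M ^ 2 ≤ t → η t = 0 := by
      intro t ht
      refine (intervalIntegral.integral_congr (g := fun _ => 0) fun y hy => ?_).trans (by simp)
      rw [Set.uIcc_of_le ht] at hy
      exact hM _ (Real.le_sqrt_of_sq_le hy.1)
    have hηc : Continuous η := continuous_iff_continuousAt.2 fun t => (hηd t).continuousAt
    have hψs : ∀ s, 0 < s → ψ (s ^ 2) = g s := fun s hs => by
      simp [hψ, Real.sqrt_sq hs.le]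
    have h1 := integral_radial_mul_dirD hf e hηd hψc hη0
    have hψ0 : ∀ t, M ^ 2 ≤ t → ψ t = 0 := fun t ht => hM _ (Real.le_sqrt_of_sq_le ht)
    have hcs : ∀ (a : ℝ → ℝ) (b : E → ℝ), Continuous a → Continuous b →
        (∀ t, M ^ 2 ≤ t → a t = 0) → Integrable fun x : E => a (‖x‖ ^ 2) * b x := by
      intro a b ha hb ha0
      have hac : Continuous fun x : E => a (‖x‖ ^ 2) := ha.comp (by fun_prop)
      refine (hac.mul hb).integrable_of_hasCompactSupport (HasCompactSupport.mul_right ?_)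
      refine HasCompactSupport.of_support_subset_isCompact (isCompact_closedBall (0 : E) M)
        fun x hx => ?_
      by_contra hx'
      rw [mem_closedBall, dist_zero_right, not_le] at hx'
      exact hx (ha0 _ (by nlinarith))
    have hpolar : ∀ (a : ℝ → ℝ) (b : E → ℝ), Continuous a → Continuous b →
        (∀ t, M ^ 2 ≤ t → a t = 0) →
        ∫ x : E, a (‖x‖ ^ 2) * b x = ∫ s in (0)..M, a (s ^ 2) * (s ^ n * sphInt 0 s b) := by
      intro a b ha hb ha0
      have h2 : ∀ s ∈ Set.Ioi (0 : ℝ), s ^ n * sphInt 0 s (fun x : E => a (‖x‖ ^ 2) * b x)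
          = (Set.Iic M).indicator (fun s => a (s ^ 2) * (s ^ n * sphInt 0 s b)) s := by
        intro s hs
        have h3 : sphInt 0 s (fun x : E => a (‖x‖ ^ 2) * b x) = a (s ^ 2) * sphInt 0 s b := by
          rw [← sphInt_const_mul]
          refine sphInt_congr (le_of_lt hs) fun x hx => ?_
          rw [sub_zero] at hx
          rw [hx]
        rw [h3]
        by_cases h : s ≤ M
        · simp [Set.indicator, h]; ring
        · have : a (s ^ 2) = 0 := ha0 _ (by have := not_le.1 h; nlinarith)
          simp [Set.indicator, h, this]
      rw [integral_eq_integral_sphInt (hcs a b ha hb ha0),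
        setIntegral_congr_fun measurableSet_Ioi h2, setIntegral_indicator measurableSet_Iic,
        Set.Ioi_inter_Iic, intervalIntegral.integral_of_le hM0.le]
    rw [hpolar η _ hηc hfd hη0, hpolar (fun t => 2 * ψ t) _ (continuous_const.mul hψc) hfe
      (fun t ht => by rw [hψ0 t ht, mul_zero])] at h1
    have hsub : ∀ s : ℝ, HasDerivAt (fun s => η (s ^ 2)) (ψ (s ^ 2) * (2 * s)) s := by
      intro s
      simpa [Function.comp_def] using (hηd (s ^ 2)).comp s (hasDerivAt_pow 2 s)
    have hc1 : Continuous fun s : ℝ => ψ (s ^ 2) := hψc.comp (continuous_pow 2)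
    have h4 := intervalIntegral.integral_mul_deriv_eq_deriv_mul (a := 0) (b := M)
      (fun s _ => hsub s) (fun s _ => hId s)
      ((hc1.mul (by fun_prop)).intervalIntegrable _ _) (hQc.intervalIntegrable _ _)
    have hI0 : I 0 = 0 := by simp [hI]
    rw [hη0 _ le_rfl, hI0] at h4
    have h5 : ∫ s in (0)..M, ψ (s ^ 2) * G s = 0 := by
      have h6 : ∀ s, ψ (s ^ 2) * G s
          = 2⁻¹ * (2 * ψ (s ^ 2) * P s - ψ (s ^ 2) * (2 * s) * I s) := fun s => by
        simp only [hG]; ring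
      have h7 : Continuous fun s => 2 * ψ (s ^ 2) * P s := by fun_prop
      have h8 : Continuous fun s => ψ (s ^ 2) * (2 * s) * I s := by fun_prop
      simp only [h6]
      rw [intervalIntegral.integral_const_mul, intervalIntegral.integral_sub
        (h7.intervalIntegrable _ _) (h8.intervalIntegrable _ _)]
      simp only [hP, hQ] at h1 h4 ⊢
      linarith
    rw [intervalIntegral.integral_of_le hM0.le] at h5
    have h9 : ∀ s, g s • G s = (Set.Ioc 0 M).indicator (fun s => ψ (s ^ 2) * G s) s := by
      intro s
      by_cases h : s ∈ Set.Ioc 0 M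
      · simp [h, hψs s h.1]
      · have : g s = 0 := by
          by_cases h0 : s ≤ 0
          · exact hg0 s h0
          · exact hM s (le_of_lt (not_le.1 fun h' => h ⟨not_le.1 h0, h'⟩))
        simp [h, this]
    simp only [h9]
    rw [integral_indicator measurableSet_Ioc, h5]
  have hae := isOpen_Ioi.ae_eq_zero_of_integral_contDiff_smul_eq_zero (μ := volume)
    (hGc.locallyIntegrable.locallyIntegrableOn (Set.Ioi 0)) htest
  have hz : Set.EqOn G 0 (Set.Ioi 0) :=
    Measure.eqOn_open_of_ae_eq ((ae_restrict_iff' measurableSet_Ioi).2 hae) isOpen_Ioi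
      hGc.continuousOn continuousOn_const
  have := hz hs
  rw [setIntegral_ball_eq hfd 0 hs.le]
  simp only [hG, hP, hI, hQ, Pi.zero_apply] at this
  linarith

lemma fderiv_translate (f : E → ℝ) (p x : E) :
    fderiv ℝ (fun y => f (p + y)) x = fderiv ℝ f (p + x) := by
  exact fderiv_comp_add_left p

/-- The divergence theorem on a ball for the vector field `f e`, with `e` a constant vector. -/
lemma sphInt_mul_inner [Nontrivial E] {f : E → ℝ} (hf : ContDiff ℝ 1 f) (e p : E) {s : ℝ}
    (hs : 0 < s) :
    s ^ (Module.finrank ℝ E - 1) * sphInt p s (fun x => f x * ⟪e, x - p⟫)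
      = s * ∫ x in ball p s, dirD e f x := by
  have hfd : Continuous (dirD e f) := (contDiff_dirD (m := 0) hf (by simp) e).continuous
  have hf' : ContDiff ℝ 1 fun y => f (p + y) := hf.comp (contDiff_const.add contDiff_id)
  have h := sphInt_mul_inner_zero hf' e hs
  have hd : dirD e (fun y => f (p + y)) = fun y => dirD e f (p + y) := by
    funext y; simp only [dirD, fderiv_translate]
  have hc : Continuous fun y => dirD e f (p + y) := hfd.comp (by fun_prop)
  rw [hd, setIntegral_ball_eq hc 0 hs.le] at h
  rw [setIntegral_ball_eq hfd p hs.le]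
  simpa [sphInt] using h

/-- Green's first identity on a ball. -/
lemma sphInt_mul_euler [Nontrivial E] {f g : E → ℝ} (hf : ContDiff ℝ 1 f) (hg : ContDiff ℝ 2 g)
    (p : E) {s : ℝ} (hs : 0 < s) :
    s ^ (Module.finrank ℝ E - 1) * sphInt p s (fun x => f x * euler p g x)
      = s * ∫ x in ball p s, ((∑ i, dirD (stdOrthonormalBasis ℝ E i) f x
          * dirD (stdOrthonormalBasis ℝ E i) g x) + f x * lapl g x) := by
  have hg1 : ∀ e, ContDiff ℝ 1 (dirD e g) := fun e => contDiff_dirD hg (by norm_num) e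
  have hfg : ∀ e, ContDiff ℝ 1 fun x => f x * dirD e g x := fun e => hf.mul (hg1 e)
  have h1 : ∀ x, f x * euler p g x = ∑ i, (f x * dirD (stdOrthonormalBasis ℝ E i) g x)
      * ⟪stdOrthonormalBasis ℝ E i, x - p⟫ := by
    intro x
    rw [euler_eq_sum, Finset.mul_sum]
    exact Finset.sum_congr rfl fun i _ => by ring
  have h2 : ∀ x, (∑ i, dirD (stdOrthonormalBasis ℝ E i) f x
      * dirD (stdOrthonormalBasis ℝ E i) g x) + f x * lapl g x
      = ∑ i, dirD (stdOrthonormalBasis ℝ E i)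
          (fun y => f y * dirD (stdOrthonormalBasis ℝ E i) g y) x := by
    intro x
    rw [lapl, Finset.mul_sum, ← Finset.sum_add_distrib]
    exact Finset.sum_congr rfl fun i _ => (dirD_mul (hf.differentiable (by simp))
      ((hg1 _).differentiable (by simp)) _ _).symm
  simp only [h1, h2]
  have hint : ∀ i ∈ Finset.univ, IntegrableOn (dirD (stdOrthonormalBasis ℝ E i)
      (fun y => f y * dirD (stdOrthonormalBasis ℝ E i) g y)) (ball p s) := fun i _ =>
    ((contDiff_dirD (m := 0) (hfg _) (by simp) _).continuous.continuousOn.integrableOn_compact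
      (isCompact_closedBall p s)).mono_set ball_subset_closedBall
  rw [integral_finsetSum _ hint, Finset.mul_sum]
  have h3 : sphInt p s (fun x => ∑ i, (f x * dirD (stdOrthonormalBasis ℝ E i) g x)
      * ⟪stdOrthonormalBasis ℝ E i, x - p⟫) = ∑ i, sphInt p s (fun x =>
      (f x * dirD (stdOrthonormalBasis ℝ E i) g x) * ⟪stdOrthonormalBasis ℝ E i, x - p⟫) :=
    integral_finsetSum _ fun i _ => integrable_sphere
      ((hfg _).continuous.mul (continuous_const.inner (continuous_id.sub continuous_const))) p s
  rw [h3, Finset.mul_sum]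
  exact Finset.sum_congr rfl fun i _ => sphInt_mul_inner (hfg _) _ p hs

end Sphere

/-! ### Mean value property and interior estimates for harmonic functions -/

section Harmonic

variable {E : Type*} [NormedAddCommGroup E] [InnerProductSpace ℝ E] [FiniteDimensional ℝ E]
  [MeasureSpace E] [BorelSpace E] [(volume : Measure E).IsAddHaarMeasure] [Nontrivial E]

lemma finrank_mul_integral_pow (r : ℝ) :
    (Module.finrank ℝ E : ℝ) * ∫ s in (0)..r, s ^ (Module.finrank ℝ E - 1)
      = r ^ Module.finrank ℝ E := by
  obtain ⟨m, hm⟩ : ∃ m, Module.finrank ℝ E = m + 1 :=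
    ⟨_, (Nat.succ_pred_eq_of_pos Module.finrank_pos).symm⟩
  rw [hm, integral_pow]
  have : (m : ℝ) + 1 ≠ 0 := by positivity
  simp
  field_simp

lemma pow_finrank_sub_one_mul (s : ℝ) :
    s ^ (Module.finrank ℝ E - 1) * s = s ^ Module.finrank ℝ E := by
  rw [← pow_succ, Nat.sub_add_cancel Module.finrank_pos]

/-- The mean value property on spheres. Only `C²` regularity is assumed, since this lemma is also
used to show that harmonic functions are smooth. -/
lemma sphInt_eq_of_lapl_eq_zero {f : E → ℝ} (hf : ContDiff ℝ 2 f) {p : E} {R : ℝ}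
    (h : ∀ x ∈ ball p R, lapl f x = 0) {s : ℝ} (hs0 : 0 ≤ s) (hs : s < R) :
    sphInt p s f = sphArea E * f p := by
  rw [← sphInt_zero_radius]
  rcases hs0.eq_or_lt with rfl | hs0
  · rfl
  have hf1 : ContDiff ℝ 1 f := hf.of_le (by norm_num)
  obtain ⟨t, ht, h1⟩ := exists_hasDerivAt_eq_slope (fun s => sphInt p s f)
    (fun t => sphInt p t (euler p f) / t) hs0 (continuous_sphInt hf1.continuous p).continuousOn
    fun t ht => hasDerivAt_sphInt hf1 p ht.1
  have h2 := sphInt_mul_euler (f := fun _ => (1 : ℝ)) contDiff_const hf p ht.1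
  have h3 : ∫ x in ball p t, ((∑ i, dirD (stdOrthonormalBasis ℝ E i) (fun _ => (1 : ℝ)) x
      * dirD (stdOrthonormalBasis ℝ E i) f x) + 1 * lapl f x) = 0 := by
    rw [setIntegral_congr_fun (g := fun _ => (0 : ℝ)) measurableSet_ball]
    · simp
    · intro x hx
      simp [dirD, h x (ball_subset_ball (ht.2.trans hs).le hx)]
  rw [h3, mul_zero] at h2
  have h4 : sphInt p t (euler p f) = 0 := by
    simpa [ht.1.ne'] using h2
  rw [h4, zero_div, eq_comm, div_eq_zero_iff] at h1
  rcases h1 with h1 | h1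
  · linarith
  · linarith

lemma euler_sq {f : E → ℝ} (hf : Differentiable ℝ f) (p x : E) :
    euler p (fun y => f y ^ 2) x = 2 * (f x * euler p f x) := by
  have := euler_mul hf hf p x
  simp only [pow_two, this]; ring

namespace SmoothHarmonicOn

variable {u v : E → ℝ} {p x : E} {R r s ρ : ℝ}

lemma sphInt_eq (hu : SmoothHarmonicOn u (ball p R)) (hs0 : 0 ≤ s) (hs : s < R) :
    sphInt p s u = sphArea E * u p :=
  sphInt_eq_of_lapl_eq_zero hu.contDiff_two hu.lapl_eq_zero hs0 hs

lemma continuous_euler {U : Set E} (hu : SmoothHarmonicOn u U) (p : E) :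
    Continuous (_root_.euler p u) :=
  (contDiff_euler (m := ∞) hu.smooth (by simp) p).continuous

lemma continuous_dirD {U : Set E} (hu : SmoothHarmonicOn u U) (e : E) :
    Continuous (_root_.dirD e u) :=
  (contDiff_dirD (m := ∞) hu.smooth (by simp) e).continuous

lemma continuous_sq {U : Set E} (hu : SmoothHarmonicOn u U) : Continuous fun x => u x ^ 2 :=
  hu.continuous.pow 2

lemma hasDerivAt_sphInt_sq {U : Set E} (hu : SmoothHarmonicOn u U) (p : E) (hs : 0 < s) :
    HasDerivAt (fun s => sphInt p s fun x => u x ^ 2)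
      (2 * sphInt p s (fun x => u x * _root_.euler p u x) / s) s := by
  have := hasDerivAt_sphInt (hu.contDiff_one.pow 2) p hs
  rw [funext (euler_sq hu.differentiable p), sphInt_const_mul] at this
  exact this

/-- Green's identity `∫_{∂B} u ∂_ν u = ∫_B |∇u|²`. -/
lemma sphInt_mul_euler_self (hu : SmoothHarmonicOn u (ball p R)) (hs0 : 0 < s) (hs : s ≤ R) :
    s ^ (Module.finrank ℝ E - 1) * sphInt p s (fun x => u x * _root_.euler p u x)
      = s * ∫ x in ball p s, ∑ i, _root_.dirD (stdOrthonormalBasis ℝ E i) u x ^ 2 := by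
  rw [sphInt_mul_euler hu.contDiff_one hu.contDiff_two p hs0]
  congr 1
  refine setIntegral_congr_fun measurableSet_ball fun x hx => ?_
  simp only [hu.lapl_eq_zero x (ball_subset_ball hs hx), pow_two, mul_zero, add_zero]

lemma sphInt_mul_euler_self_nonneg (hu : SmoothHarmonicOn u (ball p R)) (hs0 : 0 < s)
    (hs : s ≤ R) : 0 ≤ sphInt p s (fun x => u x * _root_.euler p u x) := by
  have h := hu.sphInt_mul_euler_self hs0 hs
  have h1 : 0 ≤ s * ∫ x in ball p s, ∑ i, _root_.dirD (stdOrthonormalBasis ℝ E i) u x ^ 2 :=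
    mul_nonneg hs0.le (integral_nonneg fun x => Finset.sum_nonneg fun i _ => sq_nonneg _)
  rw [← h] at h1
  exact nonneg_of_mul_nonneg_right h1 (by positivity)

/-- Green's second identity: the operator `euler p` is symmetric on harmonic functions, with respect
to the `L²` product on spheres about `p`. -/
lemma sphInt_mul_euler_comm (hu : SmoothHarmonicOn u (ball p R))
    (hv : SmoothHarmonicOn v (ball p R)) (hs0 : 0 < s) (hs : s ≤ R) :
    sphInt p s (fun x => u x * _root_.euler p v x)
      = sphInt p s (fun x => v x * _root_.euler p u x) := by
  have h1 := sphInt_mul_euler hu.contDiff_one hv.contDiff_two p hs0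
  have h2 := sphInt_mul_euler hv.contDiff_one hu.contDiff_two p hs0
  have h3 : s ^ (Module.finrank ℝ E - 1) ≠ 0 := by positivity
  refine mul_left_cancel₀ h3 (h1.trans (Eq.trans ?_ h2.symm))
  congr 1
  refine setIntegral_congr_fun measurableSet_ball fun x hx => ?_
  have hx' := ball_subset_ball hs hx
  simp only [hu.lapl_eq_zero x hx', hv.lapl_eq_zero x hx', mul_zero, add_zero]
  exact Finset.sum_congr rfl fun i _ => mul_comm _ _

lemma sphInt_sq_mono (hu : SmoothHarmonicOn u (ball p R)) (hs0 : 0 ≤ s) (hsr : s ≤ r)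
    (hr : r ≤ R) : sphInt p s (fun x => u x ^ 2) ≤ sphInt p r (fun x => u x ^ 2) := by
  have hc : Continuous fun s => sphInt p s fun x => u x ^ 2 :=
    continuous_sphInt hu.continuous_sq p
  have hm : MonotoneOn (fun s => sphInt p s fun x => u x ^ 2) (Set.Icc 0 r) := by
    refine monotoneOn_of_hasDerivWithinAt_nonneg (convex_Icc 0 r) hc.continuousOn
      (f' := fun s => 2 * sphInt p s (fun x => u x * _root_.euler p u x) / s) ?_ ?_
    · intro t ht
      rw [interior_Icc] at ht
      exact (hu.hasDerivAt_sphInt_sq p ht.1).hasDerivWithinAt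
    · intro t ht
      rw [interior_Icc] at ht
      have := hu.sphInt_mul_euler_self_nonneg ht.1 (ht.2.le.trans hr)
      have := ht.1
      positivity
  exact hm ⟨hs0, hsr⟩ ⟨hs0.trans hsr, le_rfl⟩ hsr

/-- The mean value property on balls. -/
lemma finrank_mul_setIntegral_ball (hu : SmoothHarmonicOn u (ball p R)) (hr0 : 0 ≤ r)
    (hr : r < R) : (Module.finrank ℝ E : ℝ) * ∫ x in ball p r, u x
      = sphArea E * r ^ Module.finrank ℝ E * u p := by
  rw [setIntegral_ball_eq hu.continuous p hr0, intervalIntegral.integral_congr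
    (g := fun s => s ^ (Module.finrank ℝ E - 1) * (sphArea E * u p)),
    intervalIntegral.integral_mul_const, ← mul_assoc, finrank_mul_integral_pow]
  · ring
  · intro s hs
    rw [Set.uIcc_of_le hr0] at hs
    simp only [hu.sphInt_eq hs.1 (hs.2.trans_lt hr)]

/-- The square of a harmonic function is at most its average over a ball. -/
lemma sq_mul_le_setIntegral_ball (hu : SmoothHarmonicOn u (ball p R)) (hr0 : 0 ≤ r)
    (hr : r ≤ R) : u p ^ 2 * (sphArea E * r ^ Module.finrank ℝ E)
      ≤ Module.finrank ℝ E * ∫ x in ball p r, u x ^ 2 := by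
  have hc := continuous_sphInt hu.continuous_sq p
  have h1 : ∫ s in (0)..r, s ^ (Module.finrank ℝ E - 1) * (sphArea E * u p ^ 2)
      ≤ ∫ x in ball p r, u x ^ 2 := by
    rw [setIntegral_ball_eq hu.continuous_sq p hr0]
    refine intervalIntegral.integral_mono_on hr0 (Continuous.intervalIntegrable (by fun_prop) _ _)
      (Continuous.intervalIntegrable ((continuous_pow _).mul hc) _ _) fun s hs => ?_
    have := hu.sphInt_sq_mono le_rfl hs.1 (hs.2.trans hr)
    rw [sphInt_zero_radius] at this
    exact mul_le_mul_of_nonneg_left this (pow_nonneg hs.1 _)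
  rw [intervalIntegral.integral_mul_const] at h1
  calc _ = (Module.finrank ℝ E : ℝ) * ((∫ s in (0)..r, s ^ (Module.finrank ℝ E - 1))
        * (sphArea E * u p ^ 2)) := by
          rw [← mul_assoc (Module.finrank ℝ E : ℝ), finrank_mul_integral_pow]; ring
    _ ≤ _ := mul_le_mul_of_nonneg_left h1 (Nat.cast_nonneg _)

lemma setIntegral_ball_sq_le (hu : SmoothHarmonicOn u (ball p R)) (hr0 : 0 ≤ r)
    (hr : r ≤ R) : Module.finrank ℝ E * ∫ x in ball p r, u x ^ 2
      ≤ r ^ Module.finrank ℝ E * sphInt p r fun x => u x ^ 2 := by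
  have hc := continuous_sphInt hu.continuous_sq p
  have h1 : ∫ x in ball p r, u x ^ 2
      ≤ ∫ s in (0)..r, s ^ (Module.finrank ℝ E - 1) * sphInt p r fun x => u x ^ 2 := by
    rw [setIntegral_ball_eq hu.continuous_sq p hr0]
    refine intervalIntegral.integral_mono_on hr0
      (Continuous.intervalIntegrable ((continuous_pow _).mul hc) _ _)
      (Continuous.intervalIntegrable (by fun_prop) _ _) fun s hs => ?_
    exact mul_le_mul_of_nonneg_left (hu.sphInt_sq_mono hs.1 hs.2 hr) (pow_nonneg hs.1 _)
  rw [intervalIntegral.integral_mul_const] at h1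
  calc _ ≤ (Module.finrank ℝ E : ℝ) * ((∫ s in (0)..r, s ^ (Module.finrank ℝ E - 1))
        * sphInt p r fun x => u x ^ 2) := mul_le_mul_of_nonneg_left h1 (Nat.cast_nonneg _)
    _ = _ := by rw [← mul_assoc, finrank_mul_integral_pow]

lemma integrableOn_sq {U : Set E} (hu : SmoothHarmonicOn u U) (p : E) (r : ℝ) :
    IntegrableOn (fun x => u x ^ 2) (ball p r) :=
  (hu.continuous_sq.continuousOn.integrableOn_compact
    (isCompact_closedBall p r)).mono_set ball_subset_closedBall

/-- An interior pointwise bound by the `L²` norm over a ball. -/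
lemma sq_le_setIntegral (hu : SmoothHarmonicOn u (ball p R)) (hρ : 0 ≤ ρ)
    (hx : dist x p + ρ ≤ r) (hr : r ≤ R) : u x ^ 2 * (sphArea E * ρ ^ Module.finrank ℝ E)
      ≤ Module.finrank ℝ E * ∫ y in ball p r, u y ^ 2 := by
  have hsub : ball x ρ ⊆ ball p r := ball_subset_ball' (by linarith)
  have h1 := (hu.mono (hsub.trans (ball_subset_ball hr))).sq_mul_le_setIntegral_ball hρ le_rfl
  refine h1.trans (mul_le_mul_of_nonneg_left ?_ (Nat.cast_nonneg _))
  exact setIntegral_mono_set (hu.integrableOn_sq p r)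
    (Eventually.of_forall fun _ => sq_nonneg _) hsub.eventuallyLE

/-- An interior pointwise bound by the `L²` norm over a sphere. -/
lemma sq_le_sphInt (hu : SmoothHarmonicOn u (ball p R)) (hρ : 0 ≤ ρ)
    (hx : dist x p + ρ ≤ r) (hr : r ≤ R) : u x ^ 2 * (sphArea E * ρ ^ Module.finrank ℝ E)
      ≤ r ^ Module.finrank ℝ E * sphInt p r fun x => u x ^ 2 :=
  (hu.sq_le_setIntegral hρ hx hr).trans
    (hu.setIntegral_ball_sq_le (by linarith [dist_nonneg (x := x) (y := p)]) hr)

/-- The interior gradient estimate. -/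
lemma abs_dirD_le (hu : SmoothHarmonicOn u (ball p R)) (hρ : 0 < ρ) (hx : dist x p + ρ < R)
    {M : ℝ} (hM : ∀ y, ‖y - x‖ = ρ → |u y| ≤ M) (e : E) :
    |_root_.dirD e u x| * ρ ≤ Module.finrank ℝ E * ‖e‖ * M := by
  have hsub : ball x (R - dist x p) ⊆ ball p R := ball_subset_ball' (by linarith)
  have h1 := ((hu.dirD isOpen_ball e).mono hsub).finrank_mul_setIntegral_ball hρ.le (by linarith)
  have h2 := sphInt_mul_inner hu.contDiff_one e x hρ
  have h3 : |sphInt x ρ fun y => u y * ⟪e, y - x⟫| ≤ sphArea E * (M * (‖e‖ * ρ)) := by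
    refine abs_sphInt_le hρ.le (hu.continuous.mul (by fun_prop)) fun y hy => ?_
    change |u y * ⟪e, y - x⟫| ≤ _
    rw [abs_mul]
    refine mul_le_mul (hM y hy) ?_ (abs_nonneg _) ((abs_nonneg _).trans (hM y hy))
    have := abs_real_inner_le_norm e (y - x)
    rwa [hy] at this
  set n := Module.finrank ℝ E
  have hσ : 0 < sphArea E := sphArea_pos
  have h4 : sphArea E * ρ ^ n * (_root_.dirD e u x * ρ)
      = n * (ρ ^ (n - 1) * sphInt x ρ fun y => u y * ⟪e, y - x⟫) := by
    rw [h2]; linear_combination (-ρ) * h1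
  have h5 : sphArea E * ρ ^ n * (|_root_.dirD e u x| * ρ)
      ≤ sphArea E * ρ ^ n * (n * ‖e‖ * M) := by
    have : sphArea E * ρ ^ n * (|_root_.dirD e u x| * ρ)
        = |sphArea E * ρ ^ n * (_root_.dirD e u x * ρ)| := by
      rw [abs_mul, abs_mul (_root_.dirD e u x), abs_of_pos hρ,
        abs_of_pos (show 0 < sphArea E * ρ ^ n by positivity)]
    rw [this, h4, abs_mul, abs_mul, abs_of_pos (show 0 < ρ ^ (n - 1) by positivity), Nat.abs_cast]
    calc (n : ℝ) * (ρ ^ (n - 1) * |sphInt x ρ fun y => u y * ⟪e, y - x⟫|)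
        ≤ n * (ρ ^ (n - 1) * (sphArea E * (M * (‖e‖ * ρ)))) := by gcongr
      _ = sphArea E * (ρ ^ (n - 1) * ρ) * (n * ‖e‖ * M) := by ring
      _ = _ := by rw [pow_finrank_sub_one_mul]
  exact le_of_mul_le_mul_left h5 (by positivity)

end SmoothHarmonicOn

end Harmonic

/-! ### Almgren's frequency function -/

section Frequency

variable {E : Type*} [NormedAddCommGroup E] [InnerProductSpace ℝ E] [FiniteDimensional ℝ E]
  [MeasureSpace E] [BorelSpace E] [(volume : Measure E).IsAddHaarMeasure] [Nontrivial E]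

/-- The integral of `v²` over the sphere of radius `s` about `p`, in the normalization of
`sphInt`. -/
noncomputable def sphHeight (v : E → ℝ) (p : E) (s : ℝ) : ℝ := sphInt p s fun x => v x ^ 2

/-- The frequency of `v`, as the Rayleigh quotient `⟨v, euler p v⟩ / ⟨v, v⟩` of the Euler operator
on the sphere of radius `s` about `p`. It is only meaningful where the height does not vanish. -/
noncomputable def sphFreq (v : E → ℝ) (p : E) (s : ℝ) : ℝ :=
  sphInt p s (fun x => v x * euler p v x) / sphHeight v p s

lemma sphHeight_nonneg (v : E → ℝ) (p : E) (s : ℝ) : 0 ≤ sphHeight v p s :=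
  sphInt_nonneg fun _ => sq_nonneg _

namespace SmoothHarmonicOn

variable {u v : E → ℝ} {p q x : E} {R a b r s ρ : ℝ}

lemma sphHeight_mono (hv : SmoothHarmonicOn v (ball p R)) (ha : 0 ≤ a) (hab : a ≤ b)
    (hb : b ≤ R) : sphHeight v p a ≤ sphHeight v p b :=
  hv.sphInt_sq_mono ha hab hb

lemma continuous_sphHeight {U : Set E} (hv : SmoothHarmonicOn v U) (p : E) :
    Continuous (sphHeight v p) :=
  continuous_sphInt hv.continuous_sq p

lemma hasDerivAt_sphInt_mul_euler (hv : SmoothHarmonicOn v (ball p R)) (hs0 : 0 < s)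
    (hs : s ≤ R) : HasDerivAt (fun s => sphInt p s fun x => v x * _root_.euler p v x)
      (2 * sphInt p s (fun x => _root_.euler p v x ^ 2) / s) s := by
  have he := hv.euler isOpen_ball p
  have h1 := hasDerivAt_sphInt (hv.contDiff_one.mul he.contDiff_one) p hs0
  have hc1 : Continuous fun x => _root_.euler p v x * _root_.euler p v x :=
    he.continuous.mul he.continuous
  have hc2 : Continuous fun x => v x * _root_.euler p (_root_.euler p v) x :=
    hv.continuous.mul (he.continuous_euler p)
  have h2 : sphInt p s (_root_.euler p fun x => v x * _root_.euler p v x)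
      = 2 * sphInt p s (fun x => _root_.euler p v x ^ 2) := by
    rw [funext (euler_mul hv.differentiable he.differentiable p),
      sphInt_add p s hc1 hc2, hv.sphInt_mul_euler_comm he hs0 hs]
    simp only [pow_two]; ring
  rw [← h2]
  exact h1

/-- The derivative of the frequency measures the distance of `v` from being homogeneous. -/
lemma hasDerivAt_sphFreq (hv : SmoothHarmonicOn v (ball p R)) (hs0 : 0 < s)
    (hs : s ≤ R) (hh : 0 < sphHeight v p s) :
    HasDerivAt (sphFreq v p)
      (2 / s * sphHeight (fun x => _root_.euler p v x - sphFreq v p s * v x) p s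
        / sphHeight v p s) s := by
  have hc := hv.continuous
  have hce := hv.continuous_euler p
  have h1 := (hv.hasDerivAt_sphInt_mul_euler hs0 hs).fun_div (hv.hasDerivAt_sphInt_sq p hs0) hh.ne'
  set N := sphFreq v p s with hN
  have hk : sphInt p s (fun x => v x * _root_.euler p v x) = N * sphHeight v p s := by
    rw [hN, sphFreq, div_mul_cancel₀ _ hh.ne']
  have h2 : sphHeight (fun x => _root_.euler p v x - N * v x) p s
      = sphInt p s (fun x => _root_.euler p v x ^ 2)
        - 2 * N * sphInt p s (fun x => v x * _root_.euler p v x)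
        + N ^ 2 * sphHeight v p s := by
    have hc1 : Continuous fun x => _root_.euler p v x ^ 2 := hce.pow 2
    have hc2 : Continuous fun x => 2 * N * (v x * _root_.euler p v x) := by fun_prop
    have hc3 : Continuous fun x => N ^ 2 * v x ^ 2 := by fun_prop
    have hc4 : Continuous fun x => _root_.euler p v x ^ 2 - 2 * N * (v x * _root_.euler p v x) :=
      hc1.sub hc2
    unfold sphHeight
    rw [← sphInt_const_mul, ← sphInt_const_mul, ← sphInt_sub p s hc1 hc2,
      ← sphInt_add p s hc4 hc3]
    congr 1
    funext x; ring
  have h3 : 2 / s * sphHeight (fun x => _root_.euler p v x - N * v x) p s / sphHeight v p s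
      = (2 * sphInt p s (fun x => _root_.euler p v x ^ 2) / s * sphHeight v p s
        - sphInt p s (fun x => v x * _root_.euler p v x)
          * (2 * sphInt p s (fun x => v x * _root_.euler p v x) / s)) / sphHeight v p s ^ 2 := by
    rw [h2, hk]
    have := hs0.ne'
    have := hh.ne'
    field_simp
    ring
  rw [h3]
  exact h1

lemma sphFreq_nonneg (hv : SmoothHarmonicOn v (ball p R)) (hs0 : 0 < s) (hs : s ≤ R) :
    0 ≤ sphFreq v p s :=
  div_nonneg (hv.sphInt_mul_euler_self_nonneg hs0 hs) (sphHeight_nonneg _ _ _)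

lemma sphFreq_mono_of_pos (hv : SmoothHarmonicOn v (ball p R)) (ha : 0 < a) (hab : a ≤ b)
    (hb : b ≤ R) (hh : 0 < sphHeight v p a) : sphFreq v p a ≤ sphFreq v p b := by
  have hpos : ∀ t ∈ Set.Icc a b, 0 < sphHeight v p t := fun t ht =>
    hh.trans_le (hv.sphHeight_mono ha.le ht.1 (ht.2.trans hb))
  have hd : ∀ t ∈ Set.Icc a b, HasDerivAt (sphFreq v p) _ t := fun t ht =>
    hv.hasDerivAt_sphFreq (ha.trans_le ht.1) (ht.2.trans hb) (hpos t ht)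
  refine monotoneOn_of_hasDerivWithinAt_nonneg (convex_Icc a b)
    (fun t ht => (hd t ht).continuousAt.continuousWithinAt)
    (fun t ht => (hd t (interior_subset ht)).hasDerivWithinAt) (fun t ht => ?_)
    ⟨le_rfl, hab⟩ ⟨hab, le_rfl⟩ hab
  have ht' := interior_subset ht
  have h1 : 0 < t := ha.trans_le ht'.1
  have h2 := sphHeight_nonneg (fun x => _root_.euler p v x - sphFreq v p t * v x) p t
  have h3 := hpos t ht'
  positivity

/-- Doubling: the logarithmic derivative of the height at the radius `s` is `2 N(s) / s`, so an
upper bound for the frequency limits the growth of the height. -/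
lemma sphHeight_le_of_sphFreq_le_of_pos (hv : SmoothHarmonicOn v (ball p R)) (ha : 0 < a)
    (hab : a ≤ b) (hb : b ≤ R) (hh : 0 < sphHeight v p a) {θ : ℝ} (hθ : sphFreq v p b ≤ θ) :
    sphHeight v p b ≤ (b / a) ^ (2 * θ) * sphHeight v p a := by
  have hpos : ∀ t ∈ Set.Icc a b, 0 < sphHeight v p t := fun t ht =>
    hh.trans_le (hv.sphHeight_mono ha.le ht.1 (ht.2.trans hb))
  have hd : ∀ t ∈ Set.Icc a b, HasDerivAt (fun t => sphHeight v p t * t ^ (-(2 * θ)))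
      (2 * sphInt p t (fun x => v x * _root_.euler p v x) / t * t ^ (-(2 * θ))
        + sphHeight v p t * (-(2 * θ) * t ^ (-(2 * θ) - 1))) t := fun t ht =>
    (hv.hasDerivAt_sphInt_sq p (ha.trans_le ht.1)).mul
      (Real.hasDerivAt_rpow_const (Or.inl (ha.trans_le ht.1).ne'))
  have hanti := antitoneOn_of_hasDerivWithinAt_nonpos (convex_Icc a b)
    (fun t ht => (hd t ht).continuousAt.continuousWithinAt)
    (fun t ht => (hd t (interior_subset ht)).hasDerivWithinAt) (fun t ht => ?_)
    ⟨le_rfl, hab⟩ ⟨hab, le_rfl⟩ hab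
  · have hb0 : 0 < b := ha.trans_le hab
    simp only [Real.rpow_neg hb0.le, Real.rpow_neg ha.le] at hanti
    have h1 : 0 < b ^ (2 * θ) := Real.rpow_pos_of_pos hb0 _
    have h2 : 0 < a ^ (2 * θ) := Real.rpow_pos_of_pos ha _
    rw [Real.div_rpow hb0.le ha.le]
    rw [← div_eq_mul_inv, ← div_eq_mul_inv, div_le_iff₀ h1] at hanti
    calc _ ≤ _ := hanti
      _ = _ := by ring
  · have ht' := interior_subset ht
    have h1 : 0 < t := ha.trans_le ht'.1
    have h3 := hpos t ht'
    have h4 : sphInt p t (fun x => v x * _root_.euler p v x) = sphFreq v p t * sphHeight v p t := by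
      rw [sphFreq, div_mul_cancel₀ _ h3.ne']
    have h5 : sphFreq v p t ≤ θ :=
      (hv.sphFreq_mono_of_pos h1 ht'.2 hb h3).trans hθ
    have h6 : t ^ (-(2 * θ)) = t ^ (-(2 * θ) - 1) * t := by
      rw [Real.rpow_sub_one h1.ne', div_mul_cancel₀ _ h1.ne']
    have h7 : 0 < t ^ (-(2 * θ) - 1) := Real.rpow_pos_of_pos h1 _
    rw [h4, h6]
    have : 2 * (sphFreq v p t * sphHeight v p t) / t * (t ^ (-(2 * θ) - 1) * t)
        + sphHeight v p t * (-(2 * θ) * t ^ (-(2 * θ) - 1))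
        = -(2 * sphHeight v p t * t ^ (-(2 * θ) - 1) * (θ - sphFreq v p t)) := by
      field_simp; ring
    rw [this]
    have : 0 ≤ θ - sphFreq v p t := by linarith
    have : 0 ≤ 2 * sphHeight v p t * t ^ (-(2 * θ) - 1) * (θ - sphFreq v p t) := by positivity
    linarith

/-- Unique continuation: if the height vanishes at a positive radius, it vanishes at all larger
ones. Monotonicity of the frequency bounds the logarithmic derivative of the height to the right of
its last zero, where the height would have to jump. -/
lemma sphHeight_pos_of_pos (hv : SmoothHarmonicOn v (ball p R)) (ha : 0 < a) (hab : a ≤ b)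
    (hb : b ≤ R) (hh : 0 < sphHeight v p b) : 0 < sphHeight v p a := by
  by_contra hcon
  have hc := hv.continuous_sphHeight p
  set Z : Set ℝ := Set.Icc a b ∩ {t | sphHeight v p t = 0} with hZ
  have hZc : IsCompact Z := isCompact_Icc.inter_right (isClosed_eq hc continuous_const)
  have haZ : a ∈ Z := ⟨⟨le_rfl, hab⟩, le_antisymm (not_lt.1 hcon) (sphHeight_nonneg _ _ _)⟩
  obtain ⟨c, hcZ, hcmax⟩ := hZc.exists_isGreatest ⟨a, haZ⟩
  have hc0 : 0 < c := ha.trans_le hcZ.1.1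
  have hcb : c < b := lt_of_le_of_ne hcZ.1.2 fun h => by
    have := hcZ.2
    rw [Set.mem_ofPred_eq, h] at this
    exact hh.ne' this
  have hpos : ∀ t ∈ Set.Ioc c b, 0 < sphHeight v p t := fun t ht =>
    lt_of_le_of_ne (sphHeight_nonneg _ _ _) fun h =>
      absurd (hcmax ⟨⟨hcZ.1.1.trans ht.1.le, ht.2⟩, h.symm⟩) (not_le.2 ht.1)
  have hle : ∀ t ∈ Set.Ioc c b,
      sphHeight v p b ≤ (b / t) ^ (2 * sphFreq v p b) * sphHeight v p t := fun t ht =>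
    hv.sphHeight_le_of_sphFreq_le_of_pos (hc0.trans ht.1) ht.2 hb (hpos t ht) le_rfl
  have hlim : Tendsto (fun t => (b / t) ^ (2 * sphFreq v p b) * sphHeight v p t) (𝓝[>] c)
      (𝓝 ((b / c) ^ (2 * sphFreq v p b) * sphHeight v p c)) := by
    have h1 : ContinuousAt (fun t : ℝ => (b / t) ^ (2 * sphFreq v p b)) c :=
      (continuousAt_const.div continuousAt_id hc0.ne').rpow_const
        (Or.inl (div_pos (hc0.trans hcb) hc0).ne')
    exact (h1.mul hc.continuousAt).tendsto.mono_left nhdsWithin_le_nhds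
  have := ge_of_tendsto hlim (by
    filter_upwards [Ioc_mem_nhdsGT hcb] with t ht using hle t ht)
  rw [show sphHeight v p c = 0 from hcZ.2, mul_zero] at this
  linarith

/-- The frequency of a harmonic function vanishing at the centre is at least `1`: otherwise the
height would decay more slowly than `s²`. -/
lemma one_le_sphFreq (hv : SmoothHarmonicOn v (ball p R)) (ha : 0 < a) (haR : a ≤ R)
    (hh : 0 < sphHeight v p a) (h0 : v p = 0) : 1 ≤ sphFreq v p a := by
  by_contra hcon
  rw [not_le] at hcon
  set θ := sphFreq v p a with hθ
  -- differentiability at `p` gives `v = O(|x - p|)`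
  have hO := (hv.differentiable p).hasFDerivAt.isBigO_sub
  obtain ⟨C, hC⟩ := hO.bound
  obtain ⟨ε, hε, hεC⟩ := Metric.eventually_nhds_iff.1 hC
  have hsmall : ∀ s ∈ Set.Ioo 0 (min ε a),
      sphHeight v p a ≤ a ^ (2 * θ) * (sphArea E * C ^ 2) * s ^ (2 - 2 * θ) := by
    intro s hs
    have hsε : s < ε := hs.2.trans_le (min_le_left _ _)
    have hsa : s ≤ a := (hs.2.trans_le (min_le_right _ _)).le
    have h1 : sphHeight v p s ≤ sphArea E * (C * s) ^ 2 := by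
      refine sphInt_le hs.1.le hv.continuous_sq fun x hx => ?_
      have h2 := @hεC x (by rw [dist_eq_norm, hx]; exact hsε)
      rw [h0, sub_zero, hx, Real.norm_eq_abs] at h2
      rw [← sq_abs]
      exact pow_le_pow_left₀ (abs_nonneg _) h2 2
    have h3 := hv.sphHeight_le_of_sphFreq_le_of_pos hs.1 hsa haR
      (hv.sphHeight_pos_of_pos hs.1 hsa haR hh) hθ.ge
    have h4 : 0 ≤ (a / s) ^ (2 * θ) := Real.rpow_nonneg (div_nonneg ha.le hs.1.le) _
    have h5 : s ^ (2 - 2 * θ) = s ^ 2 / s ^ (2 * θ) := by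
      rw [Real.rpow_sub hs.1]; norm_cast
    calc sphHeight v p a ≤ (a / s) ^ (2 * θ) * (sphArea E * (C * s) ^ 2) :=
          h3.trans (mul_le_mul_of_nonneg_left h1 h4)
      _ = _ := by rw [Real.div_rpow ha.le hs.1.le, h5]; ring
  have hlim : Tendsto (fun s : ℝ => a ^ (2 * θ) * (sphArea E * C ^ 2) * s ^ (2 - 2 * θ)) (𝓝[>] 0)
      (𝓝 (a ^ (2 * θ) * (sphArea E * C ^ 2) * 0 ^ (2 - 2 * θ))) :=
    ((Real.continuousAt_rpow_const 0 (2 - 2 * θ) (Or.inr (by linarith))).const_mul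
      _).tendsto.mono_left nhdsWithin_le_nhds
  have := ge_of_tendsto hlim (by
    filter_upwards [Ioo_mem_nhdsGT (lt_min hε ha)] with t ht using hsmall t ht)
  rw [Real.zero_rpow (by linarith), mul_zero] at this
  linarith

/-- The height of `u - u(q)` is controlled by that of `u - u(p)` on a larger sphere. -/
lemma sphHeight_sub_le (hu : SmoothHarmonicOn u (ball p R)) (hs : 0 ≤ s) (hρ : 0 < ρ)
    (hq : dist q p + s + ρ ≤ r) (hr : r ≤ R) :
    sphHeight (fun x => u x - u q) q s * ρ ^ Module.finrank ℝ E
      ≤ 4 * r ^ Module.finrank ℝ E * sphHeight (fun x => u x - u p) p r := by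
  set n := Module.finrank ℝ E
  have hσ : 0 < sphArea E := sphArea_pos
  have hv := hu.sub_const (u p)
  set B := r ^ n * sphHeight (fun x => u x - u p) p r with hB
  have hpt : ∀ x, dist x q ≤ s → (u x - u p) ^ 2 ≤ B / (sphArea E * ρ ^ n) := by
    intro x hx
    rw [le_div_iff₀ (by positivity)]
    exact hv.sq_le_sphInt hρ.le (by linarith [dist_triangle x q p]) hr
  have h1 : sphHeight (fun x => u x - u q) q s ≤ sphArea E * (4 * (B / (sphArea E * ρ ^ n))) := by
    refine sphInt_le hs (hu.sub_const _).continuous_sq fun x hx => ?_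
    have h2 := hpt x (by rw [dist_eq_norm, hx])
    have h3 := hpt q (by simpa using hs)
    nlinarith [sq_nonneg ((u x - u p) + (u q - u p))]
  calc _ ≤ sphArea E * (4 * (B / (sphArea E * ρ ^ n))) * ρ ^ n :=
        mul_le_mul_of_nonneg_right h1 (by positivity)
    _ = _ := by rw [hB]; field_simp

end SmoothHarmonicOn

end Frequency

/-! ### Smoothness of harmonic functions -/

section Regularity

variable {E : Type*} [NormedAddCommGroup E] [InnerProductSpace ℝ E] [FiniteDimensional ℝ E]

lemma exists_contDiff_two_extension {u : E → ℝ} {p : E} {r R : ℝ} (hr : 0 < r) (hrR : r < R)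
    (hu : InnerProductSpace.HarmonicOnNhd u (ball p R)) :
    ∃ w : E → ℝ, ContDiff ℝ 2 w ∧ (∀ x ∈ ball p r, lapl w x = 0) ∧ ∀ x ∈ ball p r, w x = u x := by
  let χ : ContDiffBump p := ⟨r, (r + R) / 2, hr, by linarith⟩
  have hχ : ContDiff ℝ 2 χ := χ.contDiff
  have hw : ContDiff ℝ 2 fun x => χ x * u x := by
    rw [contDiff_iff_contDiffAt]
    intro x
    by_cases hx : x ∈ ball p R
    · exact hχ.contDiffAt.mul (hu x hx).1
    · have hx' : x ∉ tsupport χ := by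
        rw [χ.tsupport_eq, mem_closedBall]
        rw [mem_ball] at hx
        change ¬ dist x p ≤ (r + R) / 2
        linarith
      have : (fun x => χ x * u x) =ᶠ[𝓝 x] fun _ => 0 := by
        filter_upwards [notMem_tsupport_iff_eventuallyEq.1 hx'] with y hy
        simp [hy]
      exact contDiffAt_const.congr_of_eventuallyEq this
  have heq : ∀ x ∈ ball p r, χ x * u x = u x := fun x hx => by
    rw [χ.one_of_mem_closedBall (ball_subset_closedBall hx), one_mul]
  refine ⟨_, hw, fun x hx => ?_, heq⟩
  have h1 : (fun x => χ x * u x) =ᶠ[𝓝 x] u := by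
    filter_upwards [isOpen_ball.mem_nhds hx] with y hy using heq y hy
  rw [← laplacian_eq_lapl hw, (InnerProductSpace.laplacian_congr_nhds h1).self_of_nhds]
  exact (hu x (ball_subset_ball hrR.le hx)).2.self_of_nhds

variable [MeasureSpace E] [BorelSpace E] [(volume : Measure E).IsAddHaarMeasure] [Nontrivial E]

/-- Weyl's lemma for `C²` functions: averaging a harmonic function against a radial bump function
does not change it, by the mean value property, and makes it smooth. -/
lemma exists_smoothHarmonicOn {u : E → ℝ} {p : E} {r R : ℝ} (hr : 0 < r) (hrR : r < R)
    (hu : InnerProductSpace.HarmonicOnNhd u (ball p R)) :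
    ∃ w : E → ℝ, SmoothHarmonicOn w (ball p r) ∧ ∀ x ∈ ball p r, w x = u x := by
  obtain ⟨w, hw, hwl, hwu⟩ := exists_contDiff_two_extension (r := (r + R) / 2) (by linarith)
    (by linarith) hu
  set δ := (R - r) / 2 with hδ
  have hδ0 : 0 < δ := by rw [hδ]; linarith
  let b : ContDiffBump (0 : ℝ) := ⟨δ ^ 2 / 2, δ ^ 2, by positivity, half_lt_self (by positivity)⟩
  set φ : E → ℝ := fun x => b (‖x‖ ^ 2) with hφ
  have hφs : ContDiff ℝ ∞ φ := b.contDiff.comp (contDiff_norm_sq ℝ)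
  have hb0 : ∀ t, δ ^ 2 ≤ t → b t = 0 := fun t ht => b.zero_of_le_dist (by
    rw [Real.dist_eq, sub_zero]; exact ht.trans (le_abs_self t))
  have hφc : HasCompactSupport φ := by
    refine HasCompactSupport.of_support_subset_isCompact (isCompact_closedBall (0 : E) δ)
      fun x hx => ?_
    by_contra hx'
    rw [mem_closedBall, dist_zero_right, not_le] at hx'
    exact hx (hb0 _ (by nlinarith))
  have hφpos : 0 < ∫ x, φ x := by
    refine hφs.continuous.integral_pos_of_hasCompactSupport_nonneg_nonzero hφc
      (fun x => b.nonneg) (x := 0) ?_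
    have : b ((0 : ℝ)) = 1 := b.one_of_mem_closedBall (by simp [b.rIn_pos.le])
    simp [hφ, this]
  set W : E → ℝ := fun x => (∫ y, φ y)⁻¹ *
    convolution w φ (ContinuousLinearMap.mul ℝ ℝ) volume x with hW
  have hWs : ContDiff ℝ ∞ W := contDiff_const.mul
    (hφc.contDiff_convolution_right _ hw.continuous.locallyIntegrable hφs)
  have hWw : ∀ x ∈ ball p r, W x = w x := by
    intro x hx
    have h1 : convolution w φ (ContinuousLinearMap.mul ℝ ℝ) volume x = ∫ y, w (x + y) * φ y := by
      rw [convolution, ← integral_add_left_eq_self _ x]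
      simp [hφ]
    have hc1 : Continuous fun y => w (x + y) := hw.continuous.comp (by fun_prop)
    have h2 : ∫ y, w (x + y) * φ y = ∫ y, w x * φ y := by
      have hint : ∀ f : E → ℝ, Continuous f → Integrable fun y => f y * φ y := fun f hf =>
        (hf.mul hφs.continuous).integrable_of_hasCompactSupport hφc.mul_left
      rw [integral_eq_integral_sphInt (hint _ hc1),
        integral_eq_integral_sphInt (hint _ continuous_const)]
      refine setIntegral_congr_fun measurableSet_Ioi fun s hs => ?_
      have hs0 : (0 : ℝ) < s := hs
      have h3 : ∀ f : E → ℝ, sphInt 0 s (fun y => f y * φ y) = b (s ^ 2) * sphInt 0 s f := by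
        intro f
        rw [← sphInt_const_mul]
        refine sphInt_congr hs0.le fun y hy => ?_
        rw [sub_zero] at hy
        simp only [hφ, hy, mul_comm]
      have h4 : sphInt 0 s (fun y => w (x + y)) = sphInt x s w := by simp [sphInt]
      simp only [h3, h4, sphInt_const]
      by_cases hsδ : s < δ
      · have hsub : ball x δ ⊆ ball p ((r + R) / 2) := ball_subset_ball' (by
          rw [mem_ball] at hx; rw [hδ]; linarith)
        rw [sphInt_eq_of_lapl_eq_zero hw (fun y hy => hwl y (hsub hy)) hs0.le hsδ]
      · rw [hb0 _ (by have := not_lt.1 hsδ; gcongr)]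
        simp
    rw [hW]
    simp only
    rw [h1, h2, integral_const_mul]
    field_simp
  have hsub : ball p r ⊆ ball p ((r + R) / 2) := ball_subset_ball (by linarith)
  refine ⟨W, ⟨hWs, fun x hx => ?_⟩, fun x hx => (hWw x hx).trans (hwu x (hsub hx))⟩
  rw [lapl_congr (g := w) (by filter_upwards [isOpen_ball.mem_nhds hx] with y hy using hWw y hy)]
  exact hwl x (hsub hx)

end Regularity

/-! ### Spatial variation of the frequency -/

section Variation

variable {E : Type*} [NormedAddCommGroup E] [InnerProductSpace ℝ E] [FiniteDimensional ℝ E]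
  [MeasureSpace E] [BorelSpace E] [(volume : Measure E).IsAddHaarMeasure] [Nontrivial E]

namespace SmoothHarmonicOn

variable {u v : E → ℝ} {p q x : E} {R r s L : ℝ}

/-- A frequency bound propagates from the origin to every centre in the unit ball: the height about
`X` satisfies a doubling inequality, which bounds the frequency, the latter being the logarithmic
derivative of the height. -/
lemma sphFreq_le_of_mem_ball {Λ : ℝ} (hu : SmoothHarmonicOn u (ball 0 (23 / 8)))
    (h0 : 0 < sphHeight (fun x => u x - u 0) 0 (1 / 4))
    (hΛ : sphFreq (fun x => u x - u 0) 0 (23 / 8) ≤ Λ) (hp : p ∈ ball (0 : E) 1) :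
    (∀ s, 0 < s → s ≤ 3 / 2 → 0 < sphHeight (fun x => u x - u p) p s) ∧
    sphFreq (fun x => u x - u p) p (3 / 2)
      ≤ 56 * 138 ^ Module.finrank ℝ E * (23 / 2 : ℝ) ^ (2 * Λ) := by
  set n := Module.finrank ℝ E
  have hp' : dist p 0 < 1 := hp
  have hup : SmoothHarmonicOn u (ball p (15 / 8)) :=
    hu.mono (ball_subset_ball' (by linarith))
  have hv := hup.sub_const (u p)
  have hc1 := hu.sphHeight_sub_le (q := p) (s := 7 / 4) (ρ := 1 / 8) (r := 23 / 8)
    (by norm_num) (by norm_num) (by linarith) le_rfl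
  have hc2 := hup.sphHeight_sub_le (q := 0) (s := 1 / 4) (ρ := 1 / 4) (r := 3 / 2)
    (by norm_num) (by norm_num) (by rw [dist_comm]; linarith) (by norm_num)
  have hc3 := (hu.sub_const (u 0)).sphHeight_le_of_sphFreq_le_of_pos (a := 1 / 4) (b := 23 / 8)
    (by norm_num) (by norm_num) le_rfl h0 hΛ
  rw [show (23 / 8 / (1 / 4) : ℝ) = 23 / 2 by norm_num] at hc3
  have hpos : 0 < sphHeight (fun x => u x - u p) p (3 / 2) := by
    have h1 : 0 < sphHeight (fun x => u x - u 0) 0 (1 / 4) * (1 / 4) ^ n := by positivity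
    exact pos_of_mul_pos_right (h1.trans_le hc2) (by positivity)
  refine ⟨fun s hs0 hs => hv.sphHeight_pos_of_pos hs0 hs (by norm_num) hpos, ?_⟩
  set T := (23 / 2 : ℝ) ^ (2 * Λ)
  have hT : 0 < T := Real.rpow_pos_of_pos (by norm_num) _
  set K : ℝ := 16 * 138 ^ n * T with hK
  have hdouble : sphHeight (fun x => u x - u p) p (7 / 4)
      ≤ K * sphHeight (fun x => u x - u p) p (3 / 2) := by
    have e1 : (23 / 8 : ℝ) ^ n = 23 ^ n * (1 / 8) ^ n := by rw [← mul_pow]; norm_num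
    have e2 : (3 / 2 : ℝ) ^ n = 6 ^ n * (1 / 4) ^ n := by rw [← mul_pow]; norm_num
    have e3 : (138 : ℝ) ^ n = 23 ^ n * 6 ^ n := by rw [← mul_pow]; norm_num
    rw [e1] at hc1
    rw [e2] at hc2
    have hc1' : sphHeight (fun x => u x - u p) p (7 / 4)
        ≤ 4 * 23 ^ n * sphHeight (fun x => u x - u 0) 0 (23 / 8) :=
      le_of_mul_le_mul_right (by linarith) (show (0 : ℝ) < (1 / 8) ^ n by positivity)
    have hc2' : sphHeight (fun x => u x - u 0) 0 (1 / 4)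
        ≤ 4 * 6 ^ n * sphHeight (fun x => u x - u p) p (3 / 2) :=
      le_of_mul_le_mul_right (by linarith) (show (0 : ℝ) < (1 / 4) ^ n by positivity)
    calc _ ≤ 4 * 23 ^ n * (T * (4 * 6 ^ n * sphHeight (fun x => u x - u p) p (3 / 2))) :=
          hc1'.trans (mul_le_mul_of_nonneg_left (hc3.trans
            (mul_le_mul_of_nonneg_left hc2' hT.le)) (by positivity))
      _ = _ := by rw [hK, e3]; ring
  -- the mean value theorem for the height on `[3/2, 7/4]`
  obtain ⟨t, ht, hslope⟩ := exists_hasDerivAt_eq_slope (sphHeight (fun x => u x - u p) p)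
    (fun t => 2 * sphInt p t (fun x => (u x - u p) * _root_.euler p (fun x => u x - u p) x) / t)
    (show (3 / 2 : ℝ) < 7 / 4 by norm_num) (hv.continuous_sphHeight p).continuousOn
    fun t ht => hv.hasDerivAt_sphInt_sq p (by linarith [ht.1])
  have ht0 : 0 < t := by linarith [ht.1]
  have hht := hpos.trans_le (hv.sphHeight_mono (by norm_num) ht.1.le (by linarith [ht.2]))
  have hN := hv.sphFreq_mono_of_pos (by norm_num) ht.1.le (by linarith [ht.2]) hpos
  have hhm := hv.sphHeight_mono (by norm_num) ht.1.le (by linarith [ht.2])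
  have hN0 := hv.sphFreq_nonneg (s := 3 / 2) (by norm_num) (by norm_num)
  have hk : sphInt p t (fun x => (u x - u p) * _root_.euler p (fun x => u x - u p) x)
      = sphFreq (fun x => u x - u p) p t * sphHeight (fun x => u x - u p) p t := by
    rw [sphFreq, div_mul_cancel₀ _ hht.ne']
  rw [hk, eq_div_iff (by norm_num), div_mul_eq_mul_div, div_eq_iff ht0.ne'] at hslope
  set N := sphFreq (fun x => u x - u p) p (3 / 2)
  set h := sphHeight (fun x => u x - u p) p (3 / 2)
  have h1 : N * h ≤ sphFreq (fun x => u x - u p) p t * sphHeight (fun x => u x - u p) p t :=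
    mul_le_mul hN hhm hpos.le (hN0.trans hN)
  have h2 : (sphHeight (fun x => u x - u p) p (7 / 4) - h) * t ≤ K * h * (7 / 4) := by
    have : 0 ≤ K * h := by positivity
    calc _ ≤ K * h * t := mul_le_mul_of_nonneg_right (by linarith) ht0.le
      _ ≤ _ := mul_le_mul_of_nonneg_left ht.2.le this
  have h3 : N * h ≤ 56 * 138 ^ n * T * h := by
    have : 7 / 2 * (K * h) = 56 * 138 ^ n * T * h := by rw [hK]; ring
    linarith
  exact le_of_mul_le_mul_right h3 hpos

/-- Between the radii `5r/4` and `3r/2` there is one at which the derivative of the frequency is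
controlled by the drop. There `v` is close to being an eigenfunction of the Euler operator, and so
it is on the whole ball of radius `r`, by harmonicity. -/
lemma exists_abs_euler_sub_le (hv : SmoothHarmonicOn v (ball p (3 * r / 2))) (hr : 0 < r)
    (hh : 0 < sphHeight v p (r / 2)) :
    ∃ s ∈ Set.Ioo (5 * r / 4) (3 * r / 2),
      |sphFreq v p s - sphFreq v p r| ≤ sphFreq v p (3 * r / 2) - sphFreq v p (r / 2) ∧
      ∀ x, dist x p ≤ r → |_root_.euler p v x - sphFreq v p s * v x|
        ≤ √(3 * 6 ^ Module.finrank ℝ E) * √(sphHeight v p (3 * r / 2) / sphArea E)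
          * √(sphFreq v p (3 * r / 2) - sphFreq v p (r / 2)) := by
  set n := Module.finrank ℝ E
  set W := sphFreq v p (3 * r / 2) - sphFreq v p (r / 2) with hW
  have hpos : ∀ t, r / 2 ≤ t → t ≤ 3 * r / 2 → 0 < sphHeight v p t := fun t h1 h2 =>
    hh.trans_le (hv.sphHeight_mono (by linarith) h1 h2)
  have hmono : ∀ a b, r / 2 ≤ a → a ≤ b → b ≤ 3 * r / 2 → sphFreq v p a ≤ sphFreq v p b :=
    fun a b h1 h2 h3 => hv.sphFreq_mono_of_pos (by linarith) h2 h3 (hpos a h1 (h2.trans h3))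
  have hder : ∀ t ∈ Set.Icc (5 * r / 4) (3 * r / 2), HasDerivAt (sphFreq v p) _ t := fun t ht =>
    hv.hasDerivAt_sphFreq (by linarith [ht.1]) ht.2 (hpos t (by linarith [ht.1]) ht.2)
  obtain ⟨s, hs, hslope⟩ := exists_hasDerivAt_eq_slope _ _
    (show 5 * r / 4 < 3 * r / 2 by linarith)
    (fun t ht => (hder t ht).continuousAt.continuousWithinAt)
    fun t ht => hder t ⟨ht.1.le, ht.2.le⟩
  have hs0 : 0 < s := by linarith [hs.1]
  have hhs := hpos s (by linarith [hs.1]) hs.2.le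
  set g : E → ℝ := fun x => _root_.euler p v x - sphFreq v p s * v x with hg
  have hgh : SmoothHarmonicOn g (ball p (3 * r / 2)) := (hv.euler isOpen_ball p).sub_const_mul hv _
  have hW0 : 0 ≤ W := by
    have := hmono (r / 2) (3 * r / 2) le_rfl (by linarith) le_rfl
    linarith
  have hgW : sphHeight g p s ≤ 3 * W * sphHeight v p (3 * r / 2) := by
    have h1 : sphFreq v p (3 * r / 2) - sphFreq v p (5 * r / 4) ≤ W := by
      have := hmono (r / 2) (5 * r / 4) le_rfl (by linarith) (by linarith)
      linarith
    rw [eq_div_iff (by linarith), div_mul_eq_mul_div, div_eq_iff hhs.ne', div_mul_eq_mul_div,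
      div_mul_eq_mul_div, div_eq_iff hs0.ne'] at hslope
    have h2 := hv.sphHeight_mono hs0.le hs.2.le le_rfl
    have h3 : 2 * sphHeight g p s * (3 * r / 2 - 5 * r / 4)
        ≤ W * sphHeight v p (3 * r / 2) * (3 * r / 2) := by
      rw [hslope]
      have := sphHeight_nonneg v p (3 * r / 2)
      exact mul_le_mul (mul_le_mul h1 h2 hhs.le hW0) hs.2.le hs0.le (by positivity)
    refine le_of_mul_le_mul_right ?_ (show 0 < r / 2 by linarith)
    linarith
  refine ⟨s, hs, ?_, fun x hx => ?_⟩
  · have h1 := hmono r s (by linarith) (by linarith [hs.1]) hs.2.le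
    have h2 := hmono s (3 * r / 2) (by linarith [hs.1]) hs.2.le le_rfl
    have h3 := hmono (r / 2) r le_rfl (by linarith) (by linarith)
    rw [abs_of_nonneg (by linarith)]
    linarith
  · have hσ : 0 < sphArea E := sphArea_pos
    have hnn : 0 ≤ 3 * 6 ^ n * (sphHeight v p (3 * r / 2) / sphArea E) :=
      mul_nonneg (by positivity) (div_nonneg (sphHeight_nonneg _ _ _) hσ.le)
    rw [← Real.sqrt_mul (by positivity), ← Real.sqrt_mul hnn]
    refine Real.abs_le_sqrt ?_
    have h1 := hgh.sq_le_sphInt (x := x) (ρ := r / 4) (r := s) (by linarith)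
      (by linarith [hs.1]) hs.2.le
    have h2 : s ^ n ≤ 6 ^ n * (r / 4) ^ n := by
      rw [← mul_pow]
      exact pow_le_pow_left₀ hs0.le (by linarith [hs.2]) n
    have h3 : g x ^ 2 * sphArea E * (r / 4) ^ n
        ≤ 6 ^ n * (3 * W * sphHeight v p (3 * r / 2)) * (r / 4) ^ n := by
      calc _ = g x ^ 2 * (sphArea E * (r / 4) ^ n) := by ring
        _ ≤ s ^ n * sphHeight g p s := h1
        _ ≤ 6 ^ n * (r / 4) ^ n * (3 * W * sphHeight v p (3 * r / 2)) :=
          mul_le_mul h2 hgW (sphHeight_nonneg _ _ _) (by positivity)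
        _ = _ := by ring
    have h4 := le_of_mul_le_mul_right h3 (by positivity)
    rw [show 3 * 6 ^ n * (sphHeight v p (3 * r / 2) / sphArea E) * W
      = 6 ^ n * (3 * W * sphHeight v p (3 * r / 2)) / sphArea E by ring, le_div_iff₀ hσ]
    exact h4

lemma abs_le_sqrt_sphHeight (hv : SmoothHarmonicOn v (ball p (3 * r / 2))) (hr : 0 < r)
    (hx : dist x p ≤ 5 * r / 4) :
    |v x| ≤ √(3 * 6 ^ Module.finrank ℝ E) * √(sphHeight v p (3 * r / 2) / sphArea E) := by
  set n := Module.finrank ℝ E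
  have hσ : 0 < sphArea E := sphArea_pos
  rw [← Real.sqrt_mul (by positivity)]
  refine Real.abs_le_sqrt ?_
  have h1 := hv.sq_le_sphInt (x := x) (ρ := r / 4) (r := 3 * r / 2) (by linarith)
    (by linarith) le_rfl
  rw [show 3 * r / 2 = 6 * (r / 4) by ring, mul_pow] at h1
  have h3 : v x ^ 2 * sphArea E * (r / 4) ^ n
      ≤ 6 ^ n * sphHeight v p (6 * (r / 4)) * (r / 4) ^ n := by
    calc _ = v x ^ 2 * (sphArea E * (r / 4) ^ n) := by ring
      _ ≤ _ := h1
      _ = _ := by unfold sphHeight; ring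
  have h4 := le_of_mul_le_mul_right h3 (by positivity)
  rw [show 6 * (r / 4) = 3 * r / 2 by ring] at h4
  have h5 : 0 ≤ 6 ^ n * sphHeight v p (3 * r / 2) :=
    mul_nonneg (by positivity) (sphHeight_nonneg _ _ _)
  rw [mul_div_assoc', le_div_iff₀ hσ]
  linarith

/-- The identity behind the comparison of frequencies at two centres. With
`gᵢ = euler Xᵢ u - Mᵢ (u - u(Xᵢ))` and `w = ∂ₑ u`, `e = X₂ - X₁`, one has
`w = euler X₁ u - euler X₂ u`, so that `w` equals `(M₁ - M₂) (u - u(X₁))` up to a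
constant and to `g₁ - g₂`. Pairing with `u - u(X₁)` on a sphere about `X₁` kills the
constant; the symmetry of `euler X₁` and the commutation relation `[∂ₑ, euler X₁] = ∂ₑ` express
the pairing of `w` with `u - u(X₁)` through `g₁`. -/
lemma sphInt_eq_sub_mul_sphHeight {X₁ X₂ : E} (hu : SmoothHarmonicOn u (ball X₁ R)) (hs0 : 0 < s)
    (hs : s < R) (M₁ M₂ : ℝ) :
    sphInt X₁ s (fun x =>
        (u x - u X₁) * _root_.dirD (X₂ - X₁)
          (fun y => _root_.euler X₁ u y - M₁ * (u y - u X₁)) x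
        - _root_.dirD (X₂ - X₁) u x * (_root_.euler X₁ u x - M₁ * (u x - u X₁))
        - (u x - u X₁) * (_root_.euler X₁ u x - M₁ * (u x - u X₁))
        + (u x - u X₁) * (_root_.euler X₂ u x - M₂ * (u x - u X₂)))
      = (M₁ - M₂) * sphHeight (fun x => u x - u X₁) X₁ s := by
  set e := X₂ - X₁ with he
  have hv := hu.sub_const (u X₁)
  have hw := hu.dirD isOpen_ball e
  have hcomm := hv.sphInt_mul_euler_comm hw hs0 hs.le
  have hmean := hv.sphInt_eq hs0.le hs
  simp only [sub_self, mul_zero] at hmean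
  rw [euler_sub_const] at hcomm
  have hpt : ∀ x,
      (u x - u X₁) * _root_.dirD e (fun y => _root_.euler X₁ u y - M₁ * (u y - u X₁)) x
        - _root_.dirD e u x * (_root_.euler X₁ u x - M₁ * (u x - u X₁))
        - (u x - u X₁) * (_root_.euler X₁ u x - M₁ * (u x - u X₁))
        + (u x - u X₁) * (_root_.euler X₂ u x - M₂ * (u x - u X₂))
      = ((u x - u X₁) * _root_.euler X₁ (_root_.dirD e u) x
          - _root_.dirD e u x * _root_.euler X₁ u x)
        + ((M₁ - M₂) * (u x - u X₁) ^ 2 + M₂ * (u X₂ - u X₁) * (u x - u X₁)) := by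
    intro x
    have h1 : _root_.dirD e (fun y => _root_.euler X₁ u y - M₁ * (u y - u X₁)) x
        = _root_.dirD e u x + _root_.euler X₁ (_root_.dirD e u) x - M₁ * _root_.dirD e u x := by
      rw [dirD_sub (hu.euler isOpen_ball X₁).differentiable (hv.differentiable.const_mul M₁),
        dirD_const_mul hv.differentiable, dirD_euler hu.contDiff_two, dirD_sub_const]
    have h2 : _root_.euler X₂ u x = _root_.euler X₁ u x - _root_.dirD e u x := by
      unfold _root_.euler _root_.dirD
      rw [← map_sub, he]
      congr 1; abel
    rw [h1, h2]; ring
  have c1 : Continuous fun x => (u x - u X₁) * _root_.euler X₁ (_root_.dirD e u) x :=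
    hv.continuous.mul (hw.continuous_euler X₁)
  have c2 : Continuous fun x => _root_.dirD e u x * _root_.euler X₁ u x :=
    hw.continuous.mul (hu.continuous_euler X₁)
  have c3 : Continuous fun x => (M₁ - M₂) * (u x - u X₁) ^ 2 :=
    continuous_const.mul hv.continuous_sq
  have c4 : Continuous fun x => M₂ * (u X₂ - u X₁) * (u x - u X₁) :=
    continuous_const.mul hv.continuous
  have c5 : Continuous fun x => (u x - u X₁) * _root_.euler X₁ (_root_.dirD e u) x
      - _root_.dirD e u x * _root_.euler X₁ u x := c1.sub c2
  have c6 : Continuous fun x => (M₁ - M₂) * (u x - u X₁) ^ 2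
      + M₂ * (u X₂ - u X₁) * (u x - u X₁) := c3.add c4
  simp only [hpt]
  rw [sphInt_add _ _ c5 c6, sphInt_sub _ _ c1 c2, hcomm, sphInt_add _ _ c3 c4, sphInt_const_mul,
    sphInt_const_mul, hmean]
  simp [sphHeight]

/-- Heights about two nearby centres are comparable. -/
lemma sphHeight_le_of_dist_le {X₁ X₂ : E} (hu₁ : SmoothHarmonicOn u (ball X₁ (3 * r / 2)))
    (hu₂ : SmoothHarmonicOn u (ball X₂ (3 * r / 2))) (hr : 0 < r) (hX : dist X₁ X₂ ≤ r / 2)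
    (hh : 0 < sphHeight (fun x => u x - u X₂) X₂ (r / 8))
    (hL : sphFreq (fun x => u x - u X₂) X₂ (3 * r / 2) ≤ L) :
    sphHeight (fun x => u x - u X₂) X₂ (3 * r / 2)
      ≤ 12 ^ (2 * L) * (4 * 2 ^ Module.finrank ℝ E)
        * sphHeight (fun x => u x - u X₁) X₁ (3 * r / 2) := by
  set n := Module.finrank ℝ E
  have h1 := (hu₂.sub_const (u X₂)).sphHeight_le_of_sphFreq_le_of_pos (a := r / 8)
    (b := 3 * r / 2) (by linarith) (by linarith) le_rfl hh hL
  rw [show 3 * r / 2 / (r / 8) = 12 by field_simp; norm_num] at h1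
  have h2 := hu₁.sphHeight_sub_le (q := X₂) (s := r / 8) (ρ := 3 * r / 4) (r := 3 * r / 2)
    (by linarith) (by linarith) (by rw [dist_comm]; linarith) le_rfl
  rw [show (3 * r / 2) ^ n = 2 ^ n * (3 * r / 4) ^ n by rw [← mul_pow]; ring_nf] at h2
  have h3 : sphHeight (fun x => u x - u X₂) X₂ (r / 8)
      ≤ 4 * 2 ^ n * sphHeight (fun x => u x - u X₁) X₁ (3 * r / 2) :=
    le_of_mul_le_mul_right (by linarith) (show 0 < (3 * r / 4) ^ n by positivity)
  have hT : (0 : ℝ) < 12 ^ (2 * L) := Real.rpow_pos_of_pos (by norm_num) _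
  calc _ ≤ _ := h1
    _ ≤ _ := mul_le_mul_of_nonneg_left h3 hT.le
    _ = _ := by ring

end SmoothHarmonicOn

/-- The constant governing the pointwise bounds in the comparison of frequencies at two centres:
`√(3 · 6ⁿ)` comes from the interior estimates, the second factor from the comparison of heights. -/
noncomputable def shiftConst (n : ℕ) (L : ℝ) : ℝ :=
  √(3 * 6 ^ n) * √(12 ^ (2 * L) * (4 * 2 ^ n))

namespace SmoothHarmonicOn

variable {u v : E → ℝ} {p q x : E} {R r s L : ℝ}

lemma shiftConst_nonneg (n : ℕ) (L : ℝ) : 0 ≤ shiftConst n L := by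
  unfold shiftConst; positivity

/-- Both functions `gᵢ = euler Xᵢ u - Mᵢ (u - u(Xᵢ))` are small near `X₁`, relative to the height
about `X₁`, where `Mᵢ` is the frequency about `Xᵢ` at a radius close to `r`. -/
lemma exists_euler_sub_le_of_dist_le {X₁ X₂ : E} (hu₁ : SmoothHarmonicOn u (ball X₁ (3 * r / 2)))
    (hu₂ : SmoothHarmonicOn u (ball X₂ (3 * r / 2))) (hr : 0 < r) (hX : dist X₁ X₂ ≤ r / 2)
    (hh₂ : ∀ s, 0 < s → s ≤ 3 * r / 2 → 0 < sphHeight (fun x => u x - u X₂) X₂ s)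
    (hL : sphFreq (fun x => u x - u X₂) X₂ (3 * r / 2) ≤ L) :
    ∃ M, 1 ≤ M ∧ |M - sphFreq (fun x => u x - u X₂) X₂ r|
        ≤ sphFreq (fun x => u x - u X₂) X₂ (3 * r / 2) - sphFreq (fun x => u x - u X₂) X₂ (r / 2) ∧
      ∀ x, dist x X₂ ≤ r → |_root_.euler X₂ u x - M * (u x - u X₂)|
        ≤ shiftConst (Module.finrank ℝ E) L
          * √(sphHeight (fun x => u x - u X₁) X₁ (3 * r / 2) / sphArea E)
          * √(sphFreq (fun x => u x - u X₂) X₂ (3 * r / 2)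
            - sphFreq (fun x => u x - u X₂) X₂ (r / 2)) := by
  have hσ : 0 < sphArea E := sphArea_pos
  have hv := hu₂.sub_const (u X₂)
  obtain ⟨s, hs, h1, h2⟩ := hv.exists_abs_euler_sub_le hr (hh₂ _ (by linarith) (by linarith))
  have hs0 : 0 < s := by linarith [hs.1]
  refine ⟨_, hv.one_le_sphFreq hs0 hs.2.le (hh₂ s hs0 hs.2.le) (sub_self _), h1, fun x hx => ?_⟩
  have h3 := h2 x hx
  rw [euler_sub_const] at h3
  refine h3.trans (mul_le_mul_of_nonneg_right ?_ (Real.sqrt_nonneg _))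
  have h4 : (0 : ℝ) ≤ 12 ^ (2 * L) * (4 * 2 ^ Module.finrank ℝ E) := by positivity
  rw [shiftConst, mul_assoc, ← Real.sqrt_mul h4]
  refine mul_le_mul_of_nonneg_left (Real.sqrt_le_sqrt ?_) (Real.sqrt_nonneg _)
  rw [mul_div_assoc']
  exact div_le_div_of_nonneg_right (hu₁.sphHeight_le_of_dist_le hu₂ hr hX
    (hh₂ _ (by linarith) (by linarith)) hL) hσ.le

/-- The first estimate, for frequencies about two centres. The identity
`sphInt_eq_sub_mul_sphHeight` is used on the sphere of radius `r / 4` about `X₁`, which leaves room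
for the gradient estimate. -/
lemma abs_sphFreq_sub_le {X₁ X₂ : E} (hu₁ : SmoothHarmonicOn u (ball X₁ (3 * r / 2)))
    (hu₂ : SmoothHarmonicOn u (ball X₂ (3 * r / 2))) (hr : 0 < r) (hX : dist X₁ X₂ ≤ r / 2)
    (hh₁ : ∀ s, 0 < s → s ≤ 3 * r / 2 → 0 < sphHeight (fun x => u x - u X₁) X₁ s)
    (hh₂ : ∀ s, 0 < s → s ≤ 3 * r / 2 → 0 < sphHeight (fun x => u x - u X₂) X₂ s)
    (hL₁ : sphFreq (fun x => u x - u X₁) X₁ (3 * r / 2) ≤ L)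
    (hL₂ : sphFreq (fun x => u x - u X₂) X₂ (3 * r / 2) ≤ L) :
    |sphFreq (fun x => u x - u X₁) X₁ r - sphFreq (fun x => u x - u X₂) X₂ r|
      ≤ (6 ^ (2 * L) * shiftConst (Module.finrank ℝ E) L ^ 2 * (4 * Module.finrank ℝ E + 1) + √L)
        * (√(sphFreq (fun x => u x - u X₁) X₁ (3 * r / 2)
            - sphFreq (fun x => u x - u X₁) X₁ (r / 2))
          + √(sphFreq (fun x => u x - u X₂) X₂ (3 * r / 2)
            - sphFreq (fun x => u x - u X₂) X₂ (r / 2))) := by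
  have hσ : 0 < sphArea E := sphArea_pos
  have hv := hu₁.sub_const (u X₁)
  have hv₂ := hu₂.sub_const (u X₂)
  obtain ⟨M₁, -, hM₁, hg₁⟩ := hu₁.exists_euler_sub_le_of_dist_le hu₁ hr
    (by rw [dist_self]; linarith) hh₁ hL₁
  obtain ⟨M₂, -, hM₂, hg₂⟩ := hu₁.exists_euler_sub_le_of_dist_le hu₂ hr hX hh₂ hL₂
  have hid := hu₁.sphInt_eq_sub_mul_sphHeight (X₂ := X₂) (s := r / 4) (by linarith) (by linarith)
    M₁ M₂
  set n := Module.finrank ℝ E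
  set K := shiftConst n L
  have hK : 0 ≤ K := shiftConst_nonneg n L
  set W₁ := sphFreq (fun x => u x - u X₁) X₁ (3 * r / 2)
    - sphFreq (fun x => u x - u X₁) X₁ (r / 2) with hW₁
  set W₂ := sphFreq (fun x => u x - u X₂) X₂ (3 * r / 2)
    - sphFreq (fun x => u x - u X₂) X₂ (r / 2) with hW₂
  set τ := √(sphHeight (fun x => u x - u X₁) X₁ (3 * r / 2) / sphArea E) with hτ
  have hτ0 : 0 ≤ τ := Real.sqrt_nonneg _
  set a := √W₁ with ha
  set b := √W₂ with hb
  have ha0 : 0 ≤ a := Real.sqrt_nonneg _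
  have hb0 : 0 ≤ b := Real.sqrt_nonneg _
  have hN₁ : ∀ t, 0 < t → t ≤ 3 * r / 2 → 0 ≤ sphFreq (fun x => u x - u X₁) X₁ t :=
    fun t h1 h2 => hv.sphFreq_nonneg h1 h2
  have hN₂ : ∀ t, 0 < t → t ≤ 3 * r / 2 → 0 ≤ sphFreq (fun x => u x - u X₂) X₂ t :=
    fun t h1 h2 => hv₂.sphFreq_nonneg h1 h2
  have hL0 : 0 ≤ L := (hN₁ (3 * r / 2) (by linarith) le_rfl).trans hL₁
  -- `K` dominates the constant of the interior estimate
  have hvb : ∀ x, dist x X₁ ≤ 5 * r / 4 → |u x - u X₁| ≤ K * τ := by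
    intro x hx
    refine (hv.abs_le_sqrt_sphHeight hr hx).trans (mul_le_mul_of_nonneg_right ?_ hτ0)
    refine le_mul_of_one_le_right (Real.sqrt_nonneg _) (Real.one_le_sqrt.2 ?_)
    have h1 : (1 : ℝ) ≤ 12 ^ (2 * L) := Real.one_le_rpow (by norm_num) (by linarith)
    have h2 : (1 : ℝ) ≤ 2 ^ n := one_le_pow₀ (by norm_num)
    nlinarith
  have he : ‖X₂ - X₁‖ ≤ r / 2 := by rwa [← dist_eq_norm, dist_comm]
  -- gradient estimates at distance `r / 4` from the boundary of the ball of radius `r / 2`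
  have hgrad : ∀ (f : E → ℝ) (B : ℝ), SmoothHarmonicOn f (ball X₁ (3 * r / 2)) → 0 ≤ B →
      (∀ x, dist x X₁ ≤ r / 2 → |f x| ≤ B) → ∀ x, dist x X₁ ≤ r / 4 →
      |_root_.dirD (X₂ - X₁) f x| ≤ 2 * n * B := by
    intro f B hf hB hfB x hx
    have h1 := hf.abs_dirD_le (x := x) (ρ := r / 4) (by linarith) (by linarith) (M := B)
      (fun y hy => hfB y (by
        rw [← dist_eq_norm] at hy
        linarith [dist_triangle y x X₁])) (X₂ - X₁)
    have h2 : (n : ℝ) * ‖X₂ - X₁‖ * B ≤ n * (r / 2) * B := by gcongr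
    refine le_of_mul_le_mul_right (h1.trans (h2.trans (le_of_eq ?_))) (show 0 < r / 4 by linarith)
    ring
  have hw : ∀ x, dist x X₁ ≤ r / 4 → |_root_.dirD (X₂ - X₁) u x| ≤ 2 * n * (K * τ) := by
    intro x hx
    have := hgrad _ (K * τ) hv (by positivity) (fun x hx => hvb x (by linarith)) x hx
    rwa [dirD_sub_const] at this
  have hG : SmoothHarmonicOn (fun x => _root_.euler X₁ u x - M₁ * (u x - u X₁))
      (ball X₁ (3 * r / 2)) := (hu₁.euler isOpen_ball X₁).sub_const_mul hv M₁
  have hdg := hgrad _ (K * τ * a) hG (by positivity) (fun x hx => hg₁ x (by linarith))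
  have hG₂ : Continuous fun x => _root_.euler X₂ u x - M₂ * (u x - u X₂) :=
    (hu₁.continuous_euler X₂).sub (continuous_const.mul hv₂.continuous)
  have habs := abs_sphInt_le (p := X₁) (s := r / 4) (by linarith)
    ((((hv.continuous.mul (hG.continuous_dirD (X₂ - X₁))).sub
      ((hu₁.continuous_dirD (X₂ - X₁)).mul hG.continuous)).sub
      (hv.continuous.mul hG.continuous)).add (hv.continuous.mul hG₂))
    (M := K ^ 2 * τ ^ 2 * (4 * n + 1) * (a + b)) (fun x hx => by
      have hx' : dist x X₁ = r / 4 := by rwa [dist_eq_norm]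
      have b1 := hvb x (by linarith)
      have b2 := hdg x hx'.le
      have b3 := hw x hx'.le
      have b4 := hg₁ x (by linarith)
      have b5 := hg₂ x (by linarith [dist_triangle x X₁ X₂])
      have hKτ : 0 ≤ K * τ := by positivity
      have p1 := (abs_mul _ _).trans_le (mul_le_mul b1 b2 (abs_nonneg _) hKτ)
      have p2 := (abs_mul _ _).trans_le (mul_le_mul b3 b4 (abs_nonneg _) (by positivity))
      have p3 := (abs_mul _ _).trans_le (mul_le_mul b1 b4 (abs_nonneg _) hKτ)
      have p4 := (abs_mul _ _).trans_le (mul_le_mul b1 b5 (abs_nonneg _) hKτ)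
      refine (abs_add_le _ _).trans ((add_le_add_left ((abs_sub _ _).trans
        (add_le_add_left (abs_sub _ _) _)) _).trans ?_)
      refine (add_le_add (add_le_add (add_le_add p1 p2) p3) p4).trans ?_
      have : 0 ≤ K ^ 2 * τ ^ 2 * (4 * n) * b := by positivity
      nlinarith)
  have hδ : |M₁ - M₂| ≤ 6 ^ (2 * L) * K ^ 2 * (4 * n + 1) * (a + b) := by
    have hh := hh₁ (r / 4) (by linarith) (by linarith)
    have hgrow := hv.sphHeight_le_of_sphFreq_le_of_pos (a := r / 4) (b := 3 * r / 2) (by linarith)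
      (by linarith) le_rfl hh hL₁
    rw [show 3 * r / 2 / (r / 4) = 6 by field_simp; norm_num] at hgrow
    have hτ2 : sphArea E * τ ^ 2 = sphHeight (fun x => u x - u X₁) X₁ (3 * r / 2) := by
      rw [hτ, Real.sq_sqrt (div_nonneg (sphHeight_nonneg _ _ _) hσ.le)]
      field_simp
    refine le_of_mul_le_mul_right ?_ hh
    calc |M₁ - M₂| * sphHeight (fun x => u x - u X₁) X₁ (r / 4)
        = |(M₁ - M₂) * sphHeight (fun x => u x - u X₁) X₁ (r / 4)| := by
          rw [abs_mul, abs_of_pos hh]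
      _ ≤ sphArea E * (K ^ 2 * τ ^ 2 * (4 * n + 1) * (a + b)) := by
          rw [← hid]; exact habs
      _ = K ^ 2 * (4 * n + 1) * (a + b) * (sphArea E * τ ^ 2) := by ring
      _ ≤ K ^ 2 * (4 * n + 1) * (a + b)
          * (6 ^ (2 * L) * sphHeight (fun x => u x - u X₁) X₁ (r / 4)) := by
          rw [hτ2]
          exact mul_le_mul_of_nonneg_left hgrow (by positivity)
      _ = _ := by ring
  have hW : ∀ W : ℝ, 0 ≤ W → W ≤ L → W ≤ √L * √W := by
    intro W h0 h1
    calc W = √W * √W := (Real.mul_self_sqrt h0).symm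
      _ ≤ _ := mul_le_mul_of_nonneg_right (Real.sqrt_le_sqrt h1) (Real.sqrt_nonneg _)
  have hW₁' := hW W₁ ((abs_nonneg _).trans hM₁) (by
    linarith [hN₁ (r / 2) (by linarith) (by linarith)])
  have hW₂' := hW W₂ ((abs_nonneg _).trans hM₂) (by
    linarith [hN₂ (r / 2) (by linarith) (by linarith)])
  have htri : ∀ x y : ℝ, |x - y| ≤ |M₁ - M₂| + |M₁ - x| + |M₂ - y| := by
    intro x y
    have : x - y = (M₁ - M₂) - (M₁ - x) + (M₂ - y) := by ring
    rw [this]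
    exact (abs_add_le _ _).trans (add_le_add_left (abs_sub _ _) _)
  refine (htri _ _).trans ?_
  linarith

/-- The second estimate, at a critical point `X₁`. There `g₂ = euler X₂ u - M (u - u(X₂))` takes the
value `-M (u(X₁) - u(X₂))`, and `M ≥ 1`. -/
lemma abs_sub_le_of_dirD_eq_zero {X₁ X₂ : E} (hu₁ : SmoothHarmonicOn u (ball X₁ (3 * r / 2)))
    (hu₂ : SmoothHarmonicOn u (ball X₂ (3 * r / 2))) (hr : 0 < r) (hX : dist X₁ X₂ ≤ r / 2)
    (hh₁ : ∀ s, 0 < s → s ≤ 3 * r / 2 → 0 < sphHeight (fun x => u x - u X₁) X₁ s)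
    (hh₂ : ∀ s, 0 < s → s ≤ 3 * r / 2 → 0 < sphHeight (fun x => u x - u X₂) X₂ s)
    (hL₁ : sphFreq (fun x => u x - u X₁) X₁ (3 * r / 2) ≤ L)
    (hL₂ : sphFreq (fun x => u x - u X₂) X₂ (3 * r / 2) ≤ L)
    (hgrad : ∀ e, _root_.dirD e u X₁ = 0) :
    |u X₁ - u X₂| ≤ shiftConst (Module.finrank ℝ E) L * √(6 ^ (2 * L) * 2 ^ Module.finrank ℝ E)
      * √(sphFreq (fun x => u x - u X₂) X₂ (3 * r / 2)
          - sphFreq (fun x => u x - u X₂) X₂ (r / 2))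
      * √(⨍ z in ball X₁ r, (u z - u X₁) ^ 2) := by
  have hσ : 0 < sphArea E := sphArea_pos
  have hv := hu₁.sub_const (u X₁)
  obtain ⟨M, hM1, -, hg⟩ := hu₁.exists_euler_sub_le_of_dist_le hu₂ hr hX hh₂ hL₂
  have h1 := hg X₁ (by linarith)
  have h2 : _root_.euler X₂ u X₁ = 0 := hgrad (X₁ - X₂)
  rw [h2, zero_sub, abs_neg, abs_mul, abs_of_pos (by linarith)] at h1
  have h3 : |u X₁ - u X₂| ≤ M * |u X₁ - u X₂| := le_mul_of_one_le_left (abs_nonneg _) hM1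
  refine h3.trans (h1.trans ?_)
  set n := Module.finrank ℝ E
  set A := ⨍ z in ball X₁ r, (u z - u X₁) ^ 2 with hA
  have hn : (0 : ℝ) < n := Nat.cast_pos.2 Module.finrank_pos
  have hvol : (n : ℝ) * ∫ z in ball X₁ r, (u z - u X₁) ^ 2 = sphArea E * r ^ n * A := by
    have hc : (n : ℝ) * ∫ _ in ball X₁ r, (1 : ℝ) = sphArea E * r ^ n := by
      rw [setIntegral_ball_eq continuous_const X₁ hr.le]
      simp only [sphInt_const, mul_one]
      rw [intervalIntegral.integral_mul_const, ← mul_assoc, finrank_mul_integral_pow, mul_comm]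
    rw [setIntegral_const, smul_eq_mul, mul_one] at hc
    have hpos : (volume : Measure E).real (ball X₁ r) ≠ 0 :=
      (ENNReal.toReal_pos (measure_ball_pos _ _ hr).ne' measure_ball_lt_top.ne).ne'
    rw [hA, setAverage_eq, smul_eq_mul, ← hc]
    field_simp
  have hh : sphHeight (fun x => u x - u X₁) X₁ (r / 4) ≤ sphArea E * (2 ^ n * A) := by
    refine sphInt_le (by linarith) hv.continuous_sq fun x hx => ?_
    have h4 := hv.sq_le_setIntegral (x := x) (ρ := r / 2) (r := r) (by linarith)
      (by rw [dist_eq_norm, hx]; linarith) (by linarith)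
    rw [hvol, show r ^ n = 2 ^ n * (r / 2) ^ n by rw [← mul_pow]; ring_nf] at h4
    exact le_of_mul_le_mul_right (a := sphArea E * (r / 2) ^ n) (by linarith) (by positivity)
  have hgrow := hv.sphHeight_le_of_sphFreq_le_of_pos (a := r / 4) (b := 3 * r / 2) (by linarith)
    (by linarith) le_rfl (hh₁ (r / 4) (by linarith) (by linarith)) hL₁
  rw [show 3 * r / 2 / (r / 4) = 6 by field_simp; norm_num] at hgrow
  have hT : (0 : ℝ) < 6 ^ (2 * L) := Real.rpow_pos_of_pos (by norm_num) _
  have hτ : √(sphHeight (fun x => u x - u X₁) X₁ (3 * r / 2) / sphArea E)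
      ≤ √(6 ^ (2 * L) * 2 ^ n) * √A := by
    rw [← Real.sqrt_mul (by positivity)]
    refine Real.sqrt_le_sqrt ((div_le_iff₀ hσ).2 ?_)
    calc _ ≤ _ := hgrow
      _ ≤ 6 ^ (2 * L) * (sphArea E * (2 ^ n * A)) := mul_le_mul_of_nonneg_left hh hT.le
      _ = _ := by ring
  calc _ ≤ shiftConst n L * (√(6 ^ (2 * L) * 2 ^ n) * √A) * _ :=
        mul_le_mul_of_nonneg_right (mul_le_mul_of_nonneg_left hτ (shiftConst_nonneg n L))
          (Real.sqrt_nonneg _)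
    _ = _ := by ring

end SmoothHarmonicOn

end Variation

/-! ### Back to harmonic functions on the ball of radius `3` -/

section Euclidean

variable {d : ℕ}

lemma norm_gradient_sq {f : EuclideanSpace ℝ (Fin d) → ℝ} (x : EuclideanSpace ℝ (Fin d)) :
    ‖gradient f x‖ ^ 2
      = ∑ i, dirD (stdOrthonormalBasis ℝ (EuclideanSpace ℝ (Fin d)) i) f x ^ 2 := by
  rw [← (stdOrthonormalBasis ℝ (EuclideanSpace ℝ (Fin d))).sum_sq_norm_inner_right (gradient f x)]
  refine Finset.sum_congr rfl fun i _ => ?_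
  rw [real_inner_comm, gradient, InnerProductSpace.toDual_symm_apply, Real.norm_eq_abs, sq_abs,
    dirD]

/-- The frequency of `u` is the Rayleigh quotient of the Euler operator. -/
lemma normFreq_eq_sphFreq [Nontrivial (EuclideanSpace ℝ (Fin d))]
    {u w : EuclideanSpace ℝ (Fin d) → ℝ} {p q : EuclideanSpace ℝ (Fin d)} {R s : ℝ}
    (hw : SmoothHarmonicOn w (ball p R)) (huw : ∀ x ∈ ball p R, w x = u x) (hs : 0 < s)
    (hq : dist q p + s < R) : normFreq u q s = sphFreq (fun x => w x - w q) q s := by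
  have hfin : Module.finrank ℝ (EuclideanSpace ℝ (Fin d)) = d := by simp
  have hsub : ball q s ⊆ ball p R := ball_subset_ball' (by linarith)
  have hqR : q ∈ ball p R := by rw [mem_ball]; linarith
  have hv := (hw.mono hsub).sub_const (w q)
  have hD : energyD u q s
      = ∫ x in ball q s, ∑ i, dirD (stdOrthonormalBasis ℝ (EuclideanSpace ℝ (Fin d)) i)
          (fun x => w x - w q) x ^ 2 := by
    refine setIntegral_congr_fun measurableSet_ball fun x hx => ?_
    have h1 : w =ᶠ[𝓝 x] u := by
      filter_upwards [isOpen_ball.mem_nhds (hsub hx)] with y hy using huw y hy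
    have h2 : gradient u x = gradient w x := by
      unfold gradient
      rw [h1.fderiv_eq]
    simp only [h2, norm_gradient_sq, dirD_sub_const]
  have hH : heightH u q s = s ^ (d - 1) * sphHeight (fun x => w x - w q) q s := by
    unfold heightH sphHeight
    congr 1
    refine integral_congr_ae (Eventually.of_forall fun z => ?_)
    have hz : q + s • (z : EuclideanSpace ℝ (Fin d)) ∈ ball p R := by
      rw [mem_ball]
      have h1 := dist_triangle (q + s • (z : EuclideanSpace ℝ (Fin d))) q p
      rw [dist_eq_norm (q + s • (z : EuclideanSpace ℝ (Fin d))) q,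
        sphere_norm_sub q hs.le z] at h1
      linarith
    simp only [huw _ hz, huw _ hqR]
  have hG := hv.sphInt_mul_euler_self hs le_rfl
  have hpow : s ^ (Module.finrank ℝ (EuclideanSpace ℝ (Fin d)) - 1) = s ^ (d - 1) := by rw [hfin]
  rw [hpow] at hG
  rw [normFreq, hH, hD, ← hG, sphFreq, mul_div_mul_left _ _ (by positivity)]

/-- A non-constant harmonic function is replaced by smooth functions on the whole space, on balls of
radius close to `3`; its height about the origin does not vanish there. -/
lemma exists_smooth_model [Nontrivial (EuclideanSpace ℝ (Fin d))]
    {u : EuclideanSpace ℝ (Fin d) → ℝ} (hu : InnerProductSpace.HarmonicOnNhd u (ball 0 3))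
    {x y : EuclideanSpace ℝ (Fin d)} (hx : x ∈ ball (0 : EuclideanSpace ℝ (Fin d)) 3)
    (hy : y ∈ ball (0 : EuclideanSpace ℝ (Fin d)) 3) (hxy : u x ≠ u y) {b : ℝ} (hb : b < 3) :
    ∃ ρ, b < ρ ∧ ρ < 3 ∧ ∃ w : EuclideanSpace ℝ (Fin d) → ℝ, SmoothHarmonicOn w (ball 0 ρ) ∧
      (∀ z ∈ ball (0 : EuclideanSpace ℝ (Fin d)) ρ, w z = u z) ∧
      ∀ s, 0 < s → s ≤ ρ → 0 < sphHeight (fun z => w z - w 0) 0 s := by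
  rw [mem_ball, dist_zero_right] at hx hy
  obtain ⟨ρ, hρ, hρ3⟩ := exists_between (show max b (max ‖x‖ ‖y‖) < 3 by simp [hb, hx, hy])
  simp only [max_lt_iff] at hρ
  obtain ⟨hbρ, hxρ, hyρ⟩ := hρ
  have hρ0 : 0 < ρ := (norm_nonneg x).trans_lt hxρ
  obtain ⟨w, hw, hwu⟩ := exists_smoothHarmonicOn hρ0 hρ3 hu
  refine ⟨ρ, hbρ, hρ3, w, hw, hwu, fun s hs0 hs =>
    (hw.sub_const _).sphHeight_pos_of_pos hs0 hs le_rfl ?_⟩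
  refine lt_of_le_of_ne (sphHeight_nonneg _ _ _) fun h => hxy ?_
  -- vanishing height forces `w` to be constant, contradicting `u x ≠ u y`
  have hz : ∀ z, ‖z‖ < ρ → w z = w 0 := by
    intro z hz
    have h1 := (hw.sub_const (w 0)).sq_le_sphInt (x := z) (ρ := ρ - ‖z‖) (r := ρ) (by linarith)
      (by rw [dist_zero_right]; linarith) le_rfl
    have h2 : (sphInt 0 ρ fun x => (w x - w 0) ^ 2) = 0 := h.symm
    rw [h2, mul_zero] at h1
    have h3 : 0 < sphArea (EuclideanSpace ℝ (Fin d))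
        * (ρ - ‖z‖) ^ Module.finrank ℝ (EuclideanSpace ℝ (Fin d)) :=
      mul_pos sphArea_pos (pow_pos (by linarith) _)
    have h4 : (w z - w 0) ^ 2 = 0 :=
      le_antisymm (nonpos_of_mul_nonpos_left h1 h3) (sq_nonneg _)
    exact sub_eq_zero.1 (pow_eq_zero_iff (two_ne_zero) |>.1 h4)
  rw [← hwu x (by simpa using hxρ), ← hwu y (by simpa using hyρ), hz x hxρ, hz y hyρ]

lemma normFreq_zero_mono [Nontrivial (EuclideanSpace ℝ (Fin d))]
    {u : EuclideanSpace ℝ (Fin d) → ℝ} (hu : InnerProductSpace.HarmonicOnNhd u (ball 0 3))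
    {x y : EuclideanSpace ℝ (Fin d)} (hx : x ∈ ball (0 : EuclideanSpace ℝ (Fin d)) 3)
    (hy : y ∈ ball (0 : EuclideanSpace ℝ (Fin d)) 3) (hxy : u x ≠ u y) {a b : ℝ} (ha : 0 < a)
    (hab : a ≤ b) (hb : b < 3) : normFreq u 0 a ≤ normFreq u 0 b := by
  obtain ⟨ρ, hbρ, -, w, hw, hwu, hpos⟩ := exists_smooth_model hu hx hy hxy hb
  rw [normFreq_eq_sphFreq hw hwu ha (by rw [dist_self]; linarith),
    normFreq_eq_sphFreq hw hwu (ha.trans_le hab) (by rw [dist_self]; linarith)]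
  exact (hw.sub_const _).sphFreq_mono_of_pos ha hab hbρ.le (hpos a ha (hab.trans hbρ.le))

/-- A bound, depending on the dimension and on the bound `Λ` for `N(0, 3)` only, for the frequency
about points of the unit ball. -/
noncomputable def freqBound (d : ℕ) (Λ : ℝ) : ℝ := 56 * 138 ^ d * (23 / 2) ^ (2 * Λ)

end Euclidean

theorem lemmaA1 (d : ℕ) (Λ : ℝ) :
    ∃ C : ℝ, 0 < C ∧
      ∀ u : EuclideanSpace ℝ (Fin d) → ℝ,
        InnerProductSpace.HarmonicOnNhd u (ball 0 3) →
        (∃ x ∈ ball (0 : EuclideanSpace ℝ (Fin d)) 3, ∃ y ∈ ball (0 : EuclideanSpace ℝ (Fin d)) 3,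
          u x ≠ u y) →
        -- `N(0, 3)` is the limit of `N(0, ρ)` as `ρ ↑ 3`, since `u` lives on the open ball only
        ∀ N₃ : ℝ, Tendsto (fun ρ : ℝ => normFreq u 0 ρ) (𝓝[<] 3) (𝓝 N₃) → N₃ ≤ Λ →
        ∀ r : ℝ, 0 < r → r < 1 →
        ∀ X₁ ∈ ball (0 : EuclideanSpace ℝ (Fin d)) 1,
        ∀ X₂ ∈ ball (0 : EuclideanSpace ℝ (Fin d)) 1,
          ‖X₁ - X₂‖ ≤ r / 2 →
          |normFreq u X₁ r - normFreq u X₂ r|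
              ≤ C * (Real.sqrt (freqDrop u X₁ r) + Real.sqrt (freqDrop u X₂ r)) ∧
          (gradient u X₁ = 0 →
            |u X₁ - u X₂|
              ≤ C * (Real.sqrt (freqDrop u X₁ r) + Real.sqrt (freqDrop u X₂ r))
                * Real.sqrt (⨍ Z in ball X₁ r, (u Z - u X₁) ^ 2)) := by
  set L := freqBound d Λ with hL
  have hL0 : 0 ≤ L := by rw [hL, freqBound]; positivity
  have hK0 := SmoothHarmonicOn.shiftConst_nonneg d L
  set C₁ := 6 ^ (2 * L) * shiftConst d L ^ 2 * (4 * d + 1) + √L with hC₁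
  set C₂ := shiftConst d L * √(6 ^ (2 * L) * 2 ^ d) with hC₂
  have hC₁0 : 0 ≤ C₁ := by positivity
  have hC₂0 : 0 ≤ C₂ := by positivity
  refine ⟨C₁ + C₂ + 1, by positivity, ?_⟩
  rintro u hu ⟨x, hx, y, hy, hxy⟩ N₃ hN₃ hN₃Λ r hr0 hr1 X₁ hX₁ X₂ hX₂ hX
  -- in dimension zero there are no non-constant functions
  have : Nontrivial (EuclideanSpace ℝ (Fin d)) := ⟨⟨x, y, fun h => hxy (by rw [h])⟩⟩
  have hfin : Module.finrank ℝ (EuclideanSpace ℝ (Fin d)) = d := by simp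
  obtain ⟨ρ, hρ, hρ3, w, hw, hwu, hpos⟩ :=
    exists_smooth_model hu hx hy hxy (show (23 / 8 : ℝ) < 3 by norm_num)
  have hw' : SmoothHarmonicOn w (ball 0 (23 / 8)) := hw.mono (ball_subset_ball hρ.le)
  have hΛ : sphFreq (fun x => w x - w 0) 0 (23 / 8) ≤ Λ := by
    rw [← normFreq_eq_sphFreq hw hwu (by norm_num) (by rw [dist_self]; linarith)]
    refine (ge_of_tendsto hN₃ ?_).trans hN₃Λ
    filter_upwards [Ioo_mem_nhdsLT (show (23 / 8 : ℝ) < 3 by norm_num)] with t ht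
    exact normFreq_zero_mono hu hx hy hxy (by norm_num) ht.1.le ht.2
  have hcentre : ∀ X ∈ ball (0 : EuclideanSpace ℝ (Fin d)) 1,
      SmoothHarmonicOn w (ball X (3 * r / 2)) ∧
      (∀ s, 0 < s → s ≤ 3 * r / 2 → 0 < sphHeight (fun x => w x - w X) X s) ∧
      sphFreq (fun x => w x - w X) X (3 * r / 2) ≤ L ∧
      ∀ s, 0 < s → s ≤ 3 * r / 2 → normFreq u X s = sphFreq (fun x => w x - w X) X s := by
    intro X hX
    have hX' : dist X 0 < 1 := hX
    obtain ⟨h1, h2⟩ := hw'.sphFreq_le_of_mem_ball (hpos _ (by norm_num) (by linarith)) hΛ hX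
    rw [hfin] at h2
    have h3 : SmoothHarmonicOn w (ball X (3 / 2)) :=
      hw'.mono (ball_subset_ball' (by linarith))
    refine ⟨h3.mono (ball_subset_ball (by linarith)), fun s hs0 hs => h1 s hs0 (by linarith), ?_,
      fun s hs0 hs => normFreq_eq_sphFreq hw hwu hs0 (by linarith)⟩
    exact ((h3.sub_const _).sphFreq_mono_of_pos (by linarith) (by linarith) le_rfl
      (h1 _ (by linarith) (by linarith))).trans h2
  obtain ⟨hw₁, hh₁, hL₁, hN₁⟩ := hcentre X₁ hX₁
  obtain ⟨hw₂, hh₂, hL₂, hN₂⟩ := hcentre X₂ hX₂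
  have hX' : dist X₁ X₂ ≤ r / 2 := by rwa [dist_eq_norm]
  have hmain₁ := hw₁.abs_sphFreq_sub_le hw₂ hr0 hX' hh₁ hh₂ hL₁ hL₂
  have hmain₂ := hw₁.abs_sub_le_of_dirD_eq_zero hw₂ hr0 hX' hh₁ hh₂ hL₁ hL₂
  simp only [freqDrop]
  rw [hN₁ r hr0 (by linarith), hN₂ r hr0 (by linarith), hN₁ (3 * r / 2) (by linarith) le_rfl,
    hN₂ (3 * r / 2) (by linarith) le_rfl, hN₁ (r / 2) (by linarith) (by linarith),
    hN₂ (r / 2) (by linarith) (by linarith)]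
  rw [hfin] at hmain₁ hmain₂
  set a := √(sphFreq (fun x => w x - w X₁) X₁ (3 * r / 2)
    - sphFreq (fun x => w x - w X₁) X₁ (r / 2))
  set b := √(sphFreq (fun x => w x - w X₂) X₂ (3 * r / 2)
    - sphFreq (fun x => w x - w X₂) X₂ (r / 2))
  have ha : 0 ≤ a := Real.sqrt_nonneg _
  have hb : 0 ≤ b := Real.sqrt_nonneg _
  have hin : ∀ X, dist X 0 < ρ → w X = u X := hwu
  refine ⟨hmain₁.trans (mul_le_mul_of_nonneg_right (by linarith) (by positivity)), fun hgrad => ?_⟩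
  have hX₁' : dist X₁ 0 < 1 := hX₁
  have hX₂' : dist X₂ 0 < 1 := hX₂
  have hzero : ∀ e, dirD e w X₁ = 0 := by
    intro e
    have h1 : w =ᶠ[𝓝 X₁] u := by
      filter_upwards [isOpen_ball.mem_nhds (show X₁ ∈ ball 0 ρ from hX₁'.trans (by linarith))]
        with z hz using hwu z hz
    have h2 : fderiv ℝ u X₁ = 0 := by
      rw [gradient] at hgrad
      simpa using hgrad
    rw [dirD, h1.fderiv_eq, h2]
    rfl
  have h1 := hmain₂ hzero
  have hav : ⨍ z in ball X₁ r, (w z - w X₁) ^ 2 = ⨍ z in ball X₁ r, (u z - u X₁) ^ 2 := by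
    rw [setAverage_eq, setAverage_eq]
    congr 1
    refine setIntegral_congr_fun measurableSet_ball fun z hz => ?_
    have hz' : dist z X₁ < r := hz
    simp only [hin z (by linarith [dist_triangle z X₁ 0]), hin X₁ (by linarith)]
  rw [hav, hin X₁ (by linarith), hin X₂ (by linarith)] at h1
  refine h1.trans (mul_le_mul_of_nonneg_right ?_ (Real.sqrt_nonneg _))
  exact mul_le_mul (by linarith) (by linarith) hb (by positivity)
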